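/- Let $X_1,X_2,\dots$ be i.i.d. real random variables with distribution function $F$, let $X_{1,n}\le\dots\le X_{n,n}$ be the order statistics of $X_1,\dots,X_n$, and let $U(t)=\inf\{x: F(x)\ge 1-1/t\}$, $t>1$. For $\gamma\in\mathbb R$ let $G_\gamma(x)=\exp\{-(1+\gamma x)^{-1/\gamma}\}$, $1+\gamma x>0$ (read as $\exp(-e^{-x})$ for $\gamma=0$), be the generalized extreme value distribution function. Assume that $F\in\mathcal D(G_\gamma)$ for some $\gamma\in\mathbb R$, i.e. there are $a_n>0$, $b_n\in\mathbb R$ with $F^n(a_nx+b_n)\to G_\gamma(x)$ for all $x$. Assume further that there are $\rho\le 0$, a positive measurable function $a$ and a measurable, (eventually) positive or (eventually) negative function $A_0$ with $A_0(t)\to0$ as $t\to\infty$, such that, for all $x>0$, $$\lim_{t\to\infty}\frac{1}{A_0(t)}\Bigl(\frac{U(tx)-U(t)}{a_0(t)}-\frac{x^\gamma-1}{\gamma}\Bigr)=\Psi^\star_{\gamma,\rho}(x),\qquad \lim_{t\to\infty}\frac{|A_0(tx)|}{|A_0(t)|}=x^\rho,$$ where $(x^0-1)/0$ is read as $\log x$,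 and $\Psi^\star_{\gamma,\rho}(x)=\frac{x^{\gamma+\rho}-1}{\gamma+\rho}$, $a_0=a(1-A_0)$ if $\rho<0$; $\Psi^\star_{\gamma,\rho}(x)=\frac1\gamma x^\gamma\log x$, $a_0=a(1-A_0/\gamma)$ if $\rho=0\ne\gamma$; $\Psi^\star_{\gamma,\rho}(x)=\frac12(\log x)^2$, $a_0=a$ if $\gamma=\rho=0$. Let $k=k_n$ be positive integers with $k\to\infty$, $k/n\to0$ and $\sqrt k\,A_0(n/k)\to\lambda^*\in\mathbb R$ as $n\to\infty$. Define $$\hat x^F=X_{n,n}+X_{n-k,n}-\frac1{\log2}\sum_{i=0}^{k-1}\log\Bigl(1+\frac1{k+i}\Bigr)X_{n-k-i,n},$$ $$G_{n,k}=\frac{\hat x^F-X_{n-k,n}}{X_{n-k,n}-X_{n-2k,n}},\qquad G^*_{n,k}(0)=\log 2\; G_{n,k}-\Bigl(\log k+\frac{\log2}{2}\Bigr).$$ Then, as $n\to\infty$: if $\gamma=0$, $G^*_{n,k}(0)$ converges in distribution to a random variable with the Gumbel distribution function $\exp(-e^{-z})$, $z\in\mathbb R$; if $\gamma>0$, $G^*_{n,k}(0)\to+\infty$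 in probability; if $\gamma<0$, $G^*_{n,k}(0)\to-\infty$ in probability. -/

import Mathlib

open MeasureTheory ProbabilityTheory Filter Topology

noncomputable section

namespace EndpointTest

/-- The generalized extreme value distribution function `G_γ` on the whole line
(it is `0` to the left and `1` to the right of its support); `G_0` is the Gumbel
distribution function `exp (-exp (-x))`. -/
def gev (γ x : ℝ) : ℝ :=
  if γ = 0 then Real.exp (-Real.exp (-x))
  else if 0 < 1 + γ * x then Real.exp (-(1 + γ * x) ^ (-1 / γ))
  else if 0 < γ then 0 else 1

/-- `F ∈ D(G_γ)`: the normalized maxima of a sample from `F` converge in law to `G_γ`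
(`G_γ` is continuous, so that every real `x` is a continuity point). -/
def MaxDomain (F : ℝ → ℝ) (γ : ℝ) : Prop :=
  ∃ a b : ℕ → ℝ, (∀ n, 0 < a n) ∧
    ∀ x : ℝ, Tendsto (fun n : ℕ => F (a n * x + b n) ^ n) atTop (𝓝 (gev γ x))

/-- The tail quantile function `U(t) = F^←(1 - 1/t)`, `t > 1`, where
`F^←(p) = inf {x | p ≤ F x}`. -/
def tailQuantile (F : ℝ → ℝ) (t : ℝ) : ℝ := sInf {x : ℝ | 1 - 1 / t ≤ F x}

/-- `(x ^ c - 1) / c`, read as `log x` for `c = 0`. -/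
def powerQuot (c x : ℝ) : ℝ := if c = 0 then Real.log x else (x ^ c - 1) / c

/-- The second-order limit function `Ψ*_{γ,ρ}`, `ρ ≤ 0`. -/
def secondOrderLimit (γ ρ x : ℝ) : ℝ :=
  if ρ < 0 then powerQuot (γ + ρ) x
  else if γ ≠ 0 then 1 / γ * x ^ γ * Real.log x
  else 1 / 2 * Real.log x ^ 2

/-- The modified scale function `a₀` built from `a` and `A₀`, `ρ ≤ 0`. -/
def scaleZero (γ ρ : ℝ) (a A₀ : ℝ → ℝ) (t : ℝ) : ℝ :=
  if ρ < 0 then a t * (1 - A₀ t)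
  else if γ ≠ 0 then a t * (1 - A₀ t / γ)
  else a t

/-- The second-order extended regular variation condition on `U`, with scale function `a` and
rate function `A₀` of constant sign, `A₀ → 0`, `|A₀|` regularly varying of index `ρ ≤ 0`. -/
structure SecondOrderCondition (U : ℝ → ℝ) (γ ρ : ℝ) (a A₀ : ℝ → ℝ) : Prop where
  rho_nonpos : ρ ≤ 0
  measurable_scale : Measurable a
  scale_pos : ∀ᶠ t in atTop, 0 < a t
  measurable_rate : Measurable A₀
  rate_sign : (∀ᶠ t in atTop, 0 < A₀ t) ∨ (∀ᶠ t in atTop, A₀ t < 0)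
  rate_tendsto : Tendsto A₀ atTop (𝓝 0)
  second_order : ∀ x : ℝ, 0 < x →
    Tendsto (fun t : ℝ =>
        ((U (t * x) - U t) / scaleZero γ ρ a A₀ t - powerQuot γ x) / A₀ t)
      atTop (𝓝 (secondOrderLimit γ ρ x))
  rate_regular : ∀ x : ℝ, 0 < x →
    Tendsto (fun t : ℝ => |A₀ (t * x)| / |A₀ t|) atTop (𝓝 (x ^ ρ))

/-- The ascending order statistic `X_{j,n}`, `1 ≤ j ≤ n`, of the sample
`X 0, …, X (n - 1)` (and `0` for `j` outside this range). -/
def orderStat {Ω : Type*} (X : ℕ → Ω → ℝ) (j n : ℕ) (ω : Ω) : ℝ :=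
  if h : 1 ≤ j ∧ j ≤ n then
    X (Tuple.sort (fun i : Fin n => X i ω) ⟨j - 1, by omega⟩) ω
  else 0

/-- The general right endpoint estimator based on the top `2 k` order statistics. -/
def endpointEstimator {Ω : Type*} (X : ℕ → Ω → ℝ) (k n : ℕ) (ω : Ω) : ℝ :=
  orderStat X n n ω + orderStat X (n - k) n ω
    - 1 / Real.log 2 * ∑ i ∈ Finset.range k,
        Real.log (1 + 1 / ((k : ℝ) + (i : ℝ))) * orderStat X (n - k - i) n ω

/-- The test statistic `G_{n,k}`. -/
def testStat {Ω : Type*} (X : ℕ → Ω → ℝ) (k n : ℕ) (ω : Ω) : ℝ :=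
  (endpointEstimator X k n ω - orderStat X (n - k) n ω)
    / (orderStat X (n - k) n ω - orderStat X (n - 2 * k) n ω)

/-- The normalized test statistic `G*_{n,k}(0)`. -/
def testStatStar {Ω : Type*} (X : ℕ → Ω → ℝ) (k n : ℕ) (ω : Ω) : ℝ :=
  Real.log 2 * testStat X k n ω - (Real.log k + Real.log 2 / 2)

end EndpointTest

end

/-!
The statistic is a ratio of spacings. As the weights `log (1 + 1 / (k + i))`, `i < k`, telescope to
`log 2`, one has (`log_two_mul_testStat`)
`log 2 * G = (log 2 * (X_{n,n} - X_{n-k,n}) + S) / (X_{n-k,n} - X_{n-2k,n})`, where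
`S = ∑ log (1 + 1 / (k + i)) (X_{n-k,n} - X_{n-k-i,n})` is the `weightedSpacings`. Everything is
measured in units of the scale `a₀ (n / k)` and centred at `U (n / k)`, `U` the tail quantile
function.

*Order statistics.* No quantile coupling is used. The event `X_{n-m,n} ≤ u` is an event about the
binomial number of observations up to `u`, so that Chebyshev's inequality places `X_{n-m,n}`
between `U (n / (m (1 + δ)))` and `U (n / (m (1 - δ)))` outside an event of probability
`3 / (δ² m)` (`measureReal_not_orderStat_mem`); the law of the maximum is `F ^ n`.

*Nonzero index.* The denominator is of the exact order `a₀ (n / k)` and `S` is at most `log 2` times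
the denominator. The increments `U (t x) - U t` are at least of order `x ^ (γ / 2) a₀ t` if `γ > 0`
(`SecondOrderCondition.increment_lower`) and at most of order `a₀ t` if `γ < 0`
(`SecondOrderCondition.increment_upper`). In the first case `G` outgrows the centring `log k`, in
the second case `G` stays bounded and the centring wins.

*Index zero.* Here the error in the denominator is multiplied by `log k`, hence a rate is needed.
The second-order condition holds pointwise in `x`. A measure-theoretic selection argument
(`exists_common_good`) makes it uniform for `x` in a compact set, and chaining over steps of
length `1` in logarithmic coordinates extends it to all `x ≥ 1` with an error of order
`x ^ (1 / 4) |A₀ t|` (`SecondOrderCondition.increment_log`). With `δ = k ^ (-1 / 4)` and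
`A₀ (n / k) = O(k ^ (-1 / 2))`, the normalized denominator is `log 2 + o(1 / log k)`, the normalized
`S` tends to `(log 2)² / 2` (Abel summation, with Markov's inequality to discard the few order
statistics that are not where they should be), and `(X_{n,n} - U (n / k)) / a₀ (n / k) - log k` has
distribution function `F ^ n (U (n / k) + a₀ (n / k) (z + log k)) → exp (-exp (-z))`. The statistic
differs from the latter variable by a term tending to zero in probability, and Slutsky's lemma
concludes.
-/

noncomputable section

namespace EndpointTest

/-! ### Uniformity in second-order extended regular variation -/

lemma tendsto_volume_inter_not {g : ℝ → ℝ → Prop} (hmeas : ∀ u, MeasurableSet {s | g u s})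
    (hg : ∀ s, ∀ᶠ u in atTop, g u s) {u : ℕ → ℝ} (hu : Tendsto u atTop atTop) (a b : ℝ) :
    Tendsto (fun n => volume (Set.Icc a b ∩ {s | ¬ g (u n) s})) atTop (𝓝 0) := by
  have h := tendsto_measure_of_ae_tendsto_indicator (μ := volume) (A := (∅ : Set ℝ)) atTop
    MeasurableSet.empty (As := fun n => Set.Icc a b ∩ {s | ¬ g (u n) s})
    (fun n => measurableSet_Icc.inter (hmeas (u n)).compl)
    (measurableSet_Icc (a := a) (b := b)) (by simp)
    (Eventually.of_forall fun n => Set.inter_subset_left)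
    (ae_of_all _ fun s => by
      filter_upwards [hu.eventually (hg s)] with n hn
      simp [hn])
  simpa using h

/-- Selection principle behind uniform convergence theorems of Karamata type: if a measurable
property `g u s` holds for every fixed `s` and all large `u`, then for all large `u` and every
bounded shift `v` some `s` is good for `u` while `s - v` is good for `u + v`. -/
lemma exists_common_good {g : ℝ → ℝ → Prop} (hmeas : ∀ u, MeasurableSet {s | g u s})
    (hg : ∀ s, ∀ᶠ u in atTop, g u s) :
    ∃ T, ∀ u, T ≤ u → ∀ v ∈ Set.Icc (-2 : ℝ) 2, ∃ s ∈ Set.Icc (0 : ℝ) 1,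
      g u s ∧ g (u + v) (s - v) := by
  by_contra! hcon
  choose u hu v hv hbad using fun n : ℕ => hcon n
  have hu1 : Tendsto u atTop atTop := tendsto_atTop_mono hu tendsto_natCast_atTop_atTop
  have hu2 : Tendsto (fun n => u n + v n) atTop atTop :=
    tendsto_atTop_add_right_of_le _ (-2) hu1 fun n => (hv n).1
  have h1 := tendsto_volume_inter_not hmeas hg hu1 0 1
  have h2 := tendsto_volume_inter_not hmeas hg hu2 (-2) 3
  have h3 := h1.add h2
  rw [add_zero] at h3
  obtain ⟨n, hn⟩ := (h3.eventually (gt_mem_nhds (zero_lt_one))).exists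
  have hsub : Set.Icc (0 : ℝ) 1 ⊆ (Set.Icc (0 : ℝ) 1 ∩ {s | ¬ g (u n) s}) ∪
      (fun s => s + (- v n)) ⁻¹' (Set.Icc (-2 : ℝ) 3 ∩ {s | ¬ g (u n + v n) s}) := by
    intro s hs
    by_cases hgs : g (u n) s
    · right
      have := hbad n s hs hgs
      have h4 := hv n
      simp only [Set.mem_Icc] at hs h4
      refine ⟨⟨by linarith, by linarith⟩, ?_⟩
      simpa [sub_eq_add_neg] using this
    · exact Or.inl ⟨hs, hgs⟩
  have h5 := (measure_mono hsub).trans (measure_union_le (μ := volume) _ _)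
  rw [measure_preimage_add_right] at h5
  simp only [Real.volume_Icc, sub_zero, ENNReal.ofReal_one] at h5
  exact absurd (h5.trans_lt hn) (lt_irrefl _)

/-- Uniform boundedness, on compact sets of shifts, of the second-order remainder. Everything is in
logarithmic coordinates; `H` is an additive-argument version of the tail quantile function. -/
lemma uniform_remainder {H β α φ : ℝ → ℝ} {ρ : ℝ} (hH : Monotone H)
    (hβ : ∀ᶠ u in atTop, 0 < β u) (hα_meas : Measurable α) (hα0 : ∀ u, 0 ≤ α u)
    (hα : Tendsto α atTop (𝓝 0))
    (hφ : Continuous φ)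
    (hrem : ∀ s, ∀ᶠ u in atTop, |H (u + s) - H u - β u * s| ≤ φ s * (β u * α u))
    (hup : ∀ s, ∀ᶠ u in atTop, α (u + s) ≤ (Real.exp (ρ * s) + 1) * α u)
    (hlow : ∀ s, ∀ᶠ u in atTop, α u ≤ (Real.exp (-(ρ * s)) + 1) * α (u + s)) :
    ∃ C T, 0 ≤ C ∧ ∀ u, T ≤ u → ∀ v ∈ Set.Icc (-2 : ℝ) 2,
      |H (u + v) - H u - β u * v| ≤ C * (β u * α u) := by
  obtain ⟨M, hM⟩ := (isCompact_Icc (a := (-2 : ℝ)) (b := 6)).exists_bound_of_continuousOn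
    hφ.continuousOn
  obtain ⟨c₁, hc₁⟩ := (isCompact_Icc (a := (-2 : ℝ)) (b := 6)).exists_bound_of_continuousOn
    (f := fun s => Real.exp (ρ * s) + 1) (by fun_prop)
  obtain ⟨c₂, hc₂⟩ := (isCompact_Icc (a := (-2 : ℝ)) (b := 6)).exists_bound_of_continuousOn
    (f := fun s => Real.exp (-(ρ * s)) + 1) (by fun_prop)
  simp only [Real.norm_eq_abs] at hM hc₁ hc₂
  have hM0 : 0 ≤ M := (abs_nonneg _).trans (hM 0 (by norm_num))
  have hc₁0 : 0 ≤ c₁ := (abs_nonneg _).trans (hc₁ 0 (by norm_num))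
  have hc₂0 : 0 ≤ c₂ := (abs_nonneg _).trans (hc₂ 0 (by norm_num))
  let r : ℝ → ℝ → Prop := fun u s => |H (u + s) - H u - β u * s| ≤ φ s * (β u * α u) ∧
    α (u + s) ≤ (Real.exp (ρ * s) + 1) * α u ∧ α u ≤ (Real.exp (-(ρ * s)) + 1) * α (u + s)
  have hHm : Measurable H := hH.measurable
  have hrmeas : ∀ u, MeasurableSet {s | r u s} := by
    intro u
    have hφ' := hφ.measurable
    have h1 : MeasurableSet {s | |H (u + s) - H u - β u * s| ≤ φ s * (β u * α u)} :=
      measurableSet_le (by fun_prop) (by fun_prop)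
    have h2 : MeasurableSet {s | α (u + s) ≤ (Real.exp (ρ * s) + 1) * α u} :=
      measurableSet_le (by fun_prop) (by fun_prop)
    have h3 : MeasurableSet {s | α u ≤ (Real.exp (-(ρ * s)) + 1) * α (u + s)} :=
      measurableSet_le (by fun_prop) (by fun_prop)
    exact h1.inter (h2.inter h3)
  have hr : ∀ s, ∀ᶠ u in atTop, r u s := fun s => (hrem s).and ((hup s).and (hlow s))
  obtain ⟨T₁, hT₁⟩ := exists_common_good (g := fun u s => r u s ∧ r u (s + 3))
    (fun u => (hrmeas u).inter ((hrmeas u).preimage (measurable_id.add_const 3)))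
    (fun s => (hr s).and (hr (s + 3)))
  have hsmall : ∀ᶠ u in atTop, M * α u ≤ 1 / 4 := by
    have : Tendsto (fun u => M * α u) atTop (𝓝 (M * 0)) := hα.const_mul M
    rw [mul_zero] at this
    exact this.eventually (Iic_mem_nhds (by norm_num))
  obtain ⟨T₂, hT₂⟩ := eventually_atTop.1 (hβ.and hsmall)
  refine ⟨3 * M + 6 * (M * (c₂ * c₁)), max T₁ (T₂ + 2), by positivity, fun u hu v hv => ?_⟩
  obtain ⟨s, hs, ⟨⟨he1, hαs, -⟩, ⟨he2, -, -⟩⟩, ⟨⟨he3, -, hαv⟩, ⟨he4, -, -⟩⟩⟩ :=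
    hT₁ u ((le_max_left _ _).trans hu) v hv
  have hu2 : T₂ + 2 ≤ u := (le_max_right _ _).trans hu
  simp only [Set.mem_Icc] at hs hv
  obtain ⟨hβu, hMu⟩ := hT₂ u (by linarith)
  obtain ⟨hβv, hMv⟩ := hT₂ (u + v) (by linarith)
  have hb1 := (le_abs_self _).trans (hM s ⟨by linarith, by linarith⟩)
  have hb2 := (le_abs_self _).trans (hM (s + 3) ⟨by linarith, by linarith⟩)
  have hb3 := (le_abs_self _).trans (hM (s - v) ⟨by linarith, by linarith⟩)
  have hb4 := (le_abs_self _).trans (hM (s - v + 3) ⟨by linarith, by linarith⟩)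
  have hb5 := (le_abs_self _).trans (hc₁ s ⟨by linarith, by linarith⟩)
  have hb6 := (le_abs_self _).trans (hc₂ (s - v) ⟨by linarith, by linarith⟩)
  have eq1 : u + v + (s - v) = u + s := by ring
  have eq2 : u + v + (s - v + 3) = u + (s + 3) := by ring
  rw [eq1] at he3 hαv
  rw [eq2] at he4
  have hα' : α (u + v) ≤ c₂ * c₁ * α u :=
    calc α (u + v) ≤ c₂ * α (u + s) := hαv.trans (by gcongr; exact hα0 _)
      _ ≤ c₂ * (c₁ * α u) := by
        gcongr
        exact hαs.trans (by gcongr; exact hα0 _)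
      _ = _ := by ring
  have hβα : 0 ≤ β u * α u := mul_nonneg hβu.le (hα0 _)
  have hβα' : 0 ≤ β (u + v) * α (u + v) := mul_nonneg hβv.le (hα0 _)
  replace he1 := he1.trans (mul_le_mul_of_nonneg_right hb1 hβα)
  replace he2 := he2.trans (mul_le_mul_of_nonneg_right hb2 hβα)
  replace he3 := he3.trans (mul_le_mul_of_nonneg_right hb3 hβα')
  replace he4 := he4.trans (mul_le_mul_of_nonneg_right hb4 hβα')
  have hq1 : M * (β u * α u) ≤ β u / 4 := by nlinarith
  have hq2 : M * (β (u + v) * α (u + v)) ≤ β (u + v) / 4 := by nlinarith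
  rw [abs_le] at he1 he2 he3 he4
  -- the two increments over a step of length `3` compare the scales at `u` and `u + v`
  have hd : |β u - β (u + v)| * 3 ≤
      2 * (M * (β u * α u)) + 2 * (M * (β (u + v) * α (u + v))) := by
    rw [← abs_of_pos (show (0 : ℝ) < 3 by norm_num), ← abs_mul, abs_le]
    constructor <;> linarith
  have hβ2 : β (u + v) ≤ 2 * β u := by
    have := (neg_abs_le (β u - β (u + v)))
    linarith
  have hMv' : M * (β (u + v) * α (u + v)) ≤ 2 * (M * (c₂ * c₁)) * (β u * α u) :=
    calc M * (β (u + v) * α (u + v)) ≤ M * ((2 * β u) * (c₂ * c₁ * α u)) := by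
          gcongr
          exact hα0 _
      _ = _ := by ring
  have hd' : |(β u - β (u + v)) * (s - v)| ≤ |β u - β (u + v)| * 3 := by
    rw [abs_mul]
    gcongr
    rw [abs_le]
    constructor <;> linarith
  rw [abs_le] at hd' ⊢
  constructor <;> linarith

/-- The second-order remainder at distance `w` grows at most like `exp (w / 4)`: the bound on unit
steps is propagated by comparing the scales at consecutive points. The rate `1 / 4` may be any
positive number, as the rate function has a nonpositive index. -/
lemma remainder_growth {H β α : ℝ → ℝ} {C T : ℝ} (hC : 0 ≤ C) (hα0 : ∀ u, 0 ≤ α u)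
    (hβ : ∀ u, T ≤ u → 0 < β u)
    (hrem : ∀ u, T ≤ u → ∀ v ∈ Set.Icc (0 : ℝ) 1,
      |H (u + v) - H u - β u * v| ≤ C * (β u * α u))
    (hscale : ∀ u, T ≤ u → |β (u + 1) - β u| ≤ C * (β u * α u))
    (hα : ∀ u, T ≤ u → α (u + 1) ≤ Real.exp (1 / 4) * α u)
    (hsmall : ∀ u, T ≤ u → C * α u ≤ 1 / 8) :
    ∀ u, T ≤ u → ∀ w, 0 ≤ w →
      |H (u + w) - H u - β u * w| ≤ 50 * C * Real.exp (w / 4) * (β u * α u) := by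
  intro u hu
  set θ := Real.exp (1 / 4) with hθ
  have hθ1 : 5 / 4 ≤ θ := by
    have := Real.add_one_le_exp (1 / 4 : ℝ)
    linarith
  have hβu := hβ u hu
  have hk : 0 ≤ β u * α u := mul_nonneg hβu.le (hα0 u)
  have hTj : ∀ j : ℕ, T ≤ u + j := fun j => by
    have : (0 : ℝ) ≤ j := j.cast_nonneg
    linarith
  have hαj : ∀ j : ℕ, α (u + j) ≤ θ ^ j * α u := by
    intro j
    induction j with
    | zero => simp
    | succ j ih =>
      have := hα (u + j) (hTj j)
      push_cast
      rw [← add_assoc, pow_succ]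
      nlinarith [hα0 u]
  have hθj : ∀ j : ℕ, 0 < θ ^ j := fun j => by positivity
  have hstep : ∀ j : ℕ, |β (u + j) - β u| ≤ 8 * C * (θ ^ j * (β u * α u)) →
      C * (β (u + j) * α (u + j)) ≤ 2 * C * (θ ^ j * (β u * α u)) := by
    intro j hj
    have h1 : β (u + j) ≤ β u + 8 * C * (θ ^ j * (β u * α u)) := by
      have := le_abs_self (β (u + j) - β u)
      linarith
    have h2 := hsmall (u + j) (hTj j)
    have h3 : 0 ≤ C * α (u + j) := mul_nonneg hC (hα0 _)
    have h4 : β u * (C * α (u + j)) ≤ C * (θ ^ j * (β u * α u)) := by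
      calc β u * (C * α (u + j)) ≤ β u * (C * (θ ^ j * α u)) := by
            gcongr
            exact hαj j
        _ = _ := by ring
    have h5 : 0 ≤ 8 * C * (θ ^ j * (β u * α u)) := (abs_nonneg _).trans hj
    calc C * (β (u + j) * α (u + j)) = β (u + j) * (C * α (u + j)) := by ring
      _ ≤ (β u + 8 * C * (θ ^ j * (β u * α u))) * (C * α (u + j)) := by gcongr
      _ ≤ β u * (C * α (u + j)) + 8 * C * (θ ^ j * (β u * α u)) * (1 / 8) := by
        rw [add_mul]; gcongr
      _ ≤ _ := by linarith
  have hD : ∀ j : ℕ, |β (u + j) - β u| ≤ 8 * C * (θ ^ j * (β u * α u)) := by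
    intro j
    induction j with
    | zero =>
      simp only [Nat.cast_zero, add_zero, sub_self, abs_zero]
      positivity
    | succ j ih =>
      have h1 := hscale (u + j) (hTj j)
      have h2 := hstep j ih
      push_cast
      rw [← add_assoc, pow_succ]
      have h3 := abs_sub_le (β (u + j + 1)) (β (u + j)) (β u)
      have h4 : 0 ≤ C * (θ ^ j * (β u * α u)) := by positivity
      nlinarith
  have hE : ∀ j : ℕ, |H (u + j) - H u - β u * j| ≤ 40 * C * (θ ^ j * (β u * α u)) := by
    intro j
    induction j with
    | zero =>
      simp only [Nat.cast_zero, add_zero, sub_self, mul_zero, abs_zero]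
      positivity
    | succ j ih =>
      have h1 := hrem (u + j) (hTj j) 1 (by simp)
      have h2 := hstep j (hD j)
      have h3 := hD j
      push_cast
      rw [← add_assoc, pow_succ]
      have h4 : 0 ≤ C * (θ ^ j * (β u * α u)) := by positivity
      have h5 : 40 * C * (θ ^ j * (β u * α u)) + 10 * C * (θ ^ j * (β u * α u)) ≤
          40 * C * (θ ^ j * θ * (β u * α u)) := by nlinarith
      rw [abs_le] at *
      constructor <;> linarith
  intro w hw
  set j := ⌊w⌋₊ with hj
  have hjw : (j : ℝ) ≤ w := Nat.floor_le hw
  have hjw' : w < j + 1 := Nat.lt_floor_add_one w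
  have h1 := hrem (u + j) (hTj j) (w - j) ⟨by linarith, by linarith⟩
  have h2 := hstep j (hD j)
  have h3 : |(β (u + j) - β u) * (w - j)| ≤ 8 * C * (θ ^ j * (β u * α u)) := by
    rw [abs_mul]
    calc |β (u + j) - β u| * |w - j| ≤ |β (u + j) - β u| * 1 := by
          gcongr
          rw [abs_le]; constructor <;> linarith
      _ ≤ _ := by rw [mul_one]; exact hD j
  have h4 := hE j
  have h5 : u + j + (w - j) = u + w := by ring
  rw [h5] at h1
  have h6 : θ ^ j ≤ Real.exp (w / 4) := by
    rw [hθ, ← Real.exp_nat_mul]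
    apply Real.exp_le_exp.2
    linarith
  have h7 : 50 * C * (θ ^ j * (β u * α u)) ≤ 50 * C * Real.exp (w / 4) * (β u * α u) := by
    rw [mul_assoc (50 * C)]
    gcongr
  refine le_trans ?_ h7
  rw [abs_le] at *
  constructor <;> linarith

/-! ### Growth of the tail quantile function -/

lemma SecondOrderCondition.rate_ne_zero {U : ℝ → ℝ} {γ ρ : ℝ} {a A₀ : ℝ → ℝ}
    (h : SecondOrderCondition U γ ρ a A₀) : ∀ᶠ t in atTop, A₀ t ≠ 0 := by
  rcases h.rate_sign with h | h
  · exact h.mono fun t ht => ht.ne'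
  · exact h.mono fun t ht => ht.ne

lemma SecondOrderCondition.scaleZero_pos {U : ℝ → ℝ} {γ ρ : ℝ} {a A₀ : ℝ → ℝ}
    (h : SecondOrderCondition U γ ρ a A₀) : ∀ᶠ t in atTop, 0 < scaleZero γ ρ a A₀ t := by
  have h1 : ∀ᶠ t in atTop, 0 < 1 - A₀ t := by
    have : Tendsto (fun t => 1 - A₀ t) atTop (𝓝 (1 - 0)) := h.rate_tendsto.const_sub 1
    exact this.eventually (lt_mem_nhds (by norm_num))
  have h2 : ∀ᶠ t in atTop, 0 < 1 - A₀ t / γ := by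
    have : Tendsto (fun t => 1 - A₀ t / γ) atTop (𝓝 (1 - 0 / γ)) :=
      (h.rate_tendsto.div_const γ).const_sub 1
    exact this.eventually (lt_mem_nhds (by norm_num))
  filter_upwards [h.scale_pos, h1, h2] with t ha h1 h2
  unfold scaleZero
  split_ifs <;> positivity

/-- The second-order condition implies the first-order one. -/
lemma SecondOrderCondition.first_order {U : ℝ → ℝ} {γ ρ : ℝ} {a A₀ : ℝ → ℝ}
    (h : SecondOrderCondition U γ ρ a A₀) {x : ℝ} (hx : 0 < x) :
    Tendsto (fun t => (U (t * x) - U t) / scaleZero γ ρ a A₀ t) atTop (𝓝 (powerQuot γ x)) := by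
  have h1 := ((h.second_order x hx).mul h.rate_tendsto).add_const (powerQuot γ x)
  rw [mul_zero, zero_add] at h1
  refine h1.congr' ?_
  filter_upwards [h.rate_ne_zero] with t ht
  field_simp
  ring

lemma powerQuot_pos {c x : ℝ} (hx : 1 < x) : 0 < powerQuot c x := by
  unfold powerQuot
  split_ifs with h
  · exact Real.log_pos hx
  · rcases lt_or_gt_of_ne h with h | h
    · have := Real.rpow_lt_one_of_one_lt_of_neg hx h
      exact div_pos_of_neg_of_neg (by linarith) h
    · have := Real.one_lt_rpow hx h
      exact div_pos (by linarith) h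

lemma powerQuot_lt_powerQuot {c x y : ℝ} (hx : 0 < x) (hxy : x < y) :
    powerQuot c x < powerQuot c y := by
  unfold powerQuot
  split_ifs with h
  · exact Real.log_lt_log hx hxy
  · rcases lt_or_gt_of_ne h with h | h
    · have := Real.rpow_lt_rpow_of_neg hx hxy h
      exact (div_lt_div_right_of_neg h).2 (by linarith)
    · have := Real.rpow_lt_rpow hx.le hxy h
      exact div_lt_div_of_pos_right (by linarith) h

/-- The scale function is regularly varying of index `γ`: the increment from `t e` to `t e²` is
computed on the scales at `t` and at `t e`. -/
lemma SecondOrderCondition.scaleZero_ratio {U : ℝ → ℝ} {γ ρ : ℝ} {a A₀ : ℝ → ℝ}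
    (h : SecondOrderCondition U γ ρ a A₀) (hγ : γ ≠ 0) :
    Tendsto (fun t => scaleZero γ ρ a A₀ (t * Real.exp 1) / scaleZero γ ρ a A₀ t) atTop
      (𝓝 (Real.exp γ)) := by
  set b := scaleZero γ ρ a A₀
  have he : (0 : ℝ) < Real.exp 1 := Real.exp_pos 1
  have hp : 0 < powerQuot γ (Real.exp 1) := powerQuot_pos (by simp)
  have hmul : Tendsto (fun t : ℝ => t * Real.exp 1) atTop atTop :=
    tendsto_id.atTop_mul_const he
  have h1 := (h.first_order (x := Real.exp 1 * Real.exp 1) (by positivity)).sub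
    (h.first_order he)
  have h2 := (h.first_order he).comp hmul
  have h3 := h1.div h2 hp.ne'
  have hlim : (powerQuot γ (Real.exp 1 * Real.exp 1) - powerQuot γ (Real.exp 1)) /
      powerQuot γ (Real.exp 1) = Real.exp γ := by
    unfold powerQuot at *
    simp only [hγ, if_false] at *
    rw [Real.mul_rpow he.le he.le, Real.exp_one_rpow] at *
    have : Real.exp γ - 1 ≠ 0 := fun h0 => by simp [h0] at hp
    field_simp
    ring
  rw [hlim] at h3
  refine h3.congr' ?_
  have hne : ∀ᶠ t in atTop, (U (t * Real.exp 1 * Real.exp 1) - U (t * Real.exp 1)) /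
      b (t * Real.exp 1) ≠ 0 := h2.eventually (isOpen_ne.mem_nhds hp.ne')
  filter_upwards [h.scaleZero_pos, hmul.eventually h.scaleZero_pos, hne] with t hb hb' hne
  simp only [Function.comp, Pi.div_apply, ← mul_assoc]
  change 0 < b t at hb
  change 0 < b (t * Real.exp 1) at hb'
  change ((U (t * Real.exp 1 * Real.exp 1) - U t) / b t - (U (t * Real.exp 1) - U t) / b t) /
    ((U (t * Real.exp 1 * Real.exp 1) - U (t * Real.exp 1)) / b (t * Real.exp 1)) =
    b (t * Real.exp 1) / b t
  rw [← sub_div, sub_sub_sub_cancel_right]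
  have hne' : U (t * Real.exp 1 * Real.exp 1) - U (t * Real.exp 1) ≠ 0 := fun h0 => by
    simp [h0] at hne
  generalize U (t * Real.exp 1 * Real.exp 1) - U (t * Real.exp 1) = d at hne'
  field_simp

/-- For a positive index, the increments of the tail quantile function grow at least like a
power. -/
lemma SecondOrderCondition.increment_lower {U : ℝ → ℝ} {γ ρ : ℝ} {a A₀ : ℝ → ℝ}
    (h : SecondOrderCondition U γ ρ a A₀) (hU : MonotoneOn U (Set.Ioi 1)) (hγ : 0 < γ) :
    ∃ c T, 0 < c ∧ ∀ t, T ≤ t → ∀ x, Real.exp 1 ≤ x →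
      c * x ^ (γ / 2) * scaleZero γ ρ a A₀ t ≤ U (t * x) - U t := by
  have hr := h.scaleZero_ratio hγ.ne'
  have hfo := h.first_order (Real.exp_pos 1)
  have hpos := h.scaleZero_pos
  set b := scaleZero γ ρ a A₀
  have hp : 0 < powerQuot γ (Real.exp 1) := powerQuot_pos (by simp)
  set q := powerQuot γ (Real.exp 1)
  obtain ⟨T, hT⟩ := eventually_atTop.1 (hpos.and
    ((hr.eventually (lt_mem_nhds (Real.exp_lt_exp.2 (half_lt_self hγ)))).and
      (hfo.eventually (lt_mem_nhds (half_lt_self hp)))))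
  have he : (1 : ℝ) ≤ Real.exp 1 := Real.one_le_exp (by norm_num)
  have hchain : ∀ j : ℕ, ∀ t, max T 2 ≤ t →
      Real.exp (γ / 2) ^ j * b t * (q / 2) ≤ U (t * Real.exp 1 ^ (j + 1)) - U t := by
    intro j
    induction j with
    | zero =>
      intro t ht
      obtain ⟨h1, h2, h3⟩ := hT t ((le_max_left _ _).trans ht)
      rw [lt_div_iff₀ h1] at h3
      simp only [pow_zero, zero_add, pow_one]
      linarith
    | succ j ih =>
      intro t ht
      obtain ⟨h1, h2, h3⟩ := hT t ((le_max_left _ _).trans ht)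
      have ht2 : 2 ≤ t := (le_max_right _ _).trans ht
      have h4 := ih (t * Real.exp 1) (ht.trans (le_mul_of_one_le_right (by linarith) he))
      rw [lt_div_iff₀ h1] at h2 h3
      have h5 : 0 ≤ q / 2 * b t := by positivity
      rw [mul_assoc t, ← pow_succ'] at h4
      have h6 : Real.exp (γ / 2) ^ j * (Real.exp (γ / 2) * b t) * (q / 2) ≤
          Real.exp (γ / 2) ^ j * b (t * Real.exp 1) * (q / 2) := by gcongr
      rw [pow_succ (Real.exp (γ / 2))]
      linarith
  refine ⟨q / 2 * Real.exp (-γ), max T 2, by positivity, fun t ht x hx => ?_⟩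
  have ht2 : 2 ≤ t := (le_max_right _ _).trans ht
  have hx0 : 0 < x := (Real.exp_pos 1).trans_le hx
  have hl1 : 1 ≤ Real.log x := (Real.le_log_iff_exp_le hx0).2 hx
  obtain ⟨j, hj⟩ : ∃ j, ⌊Real.log x⌋₊ = j + 1 :=
    Nat.exists_eq_succ_of_ne_zero (Nat.floor_pos.2 hl1).ne'
  have hj1 : ((j + 1 : ℕ) : ℝ) ≤ Real.log x := by
    rw [← hj]; exact Nat.floor_le (by linarith)
  have hj2 : Real.log x < ((j + 1 : ℕ) : ℝ) + 1 := by
    rw [← hj]; exact Nat.lt_floor_add_one _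
  have hxj : Real.exp 1 ^ (j + 1) ≤ x := by
    rw [← Real.exp_nat_mul, mul_one, ← Real.le_log_iff_exp_le hx0]
    exact hj1
  have hmono : U (t * Real.exp 1 ^ (j + 1)) ≤ U (t * x) := by
    have h1 : 1 ≤ Real.exp 1 ^ (j + 1) := one_le_pow₀ he
    refine hU ?_ ?_ (by gcongr)
    · simp only [Set.mem_Ioi]; nlinarith
    · simp only [Set.mem_Ioi]; nlinarith
  have hpow : x ^ (γ / 2) * Real.exp (-γ) ≤ Real.exp (γ / 2) ^ j := by
    rw [Real.rpow_def_of_pos hx0, ← Real.exp_add, ← Real.exp_nat_mul]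
    apply Real.exp_le_exp.2
    push_cast at hj2
    nlinarith
  have hb := (hT t ((le_max_left _ _).trans ht)).1
  have h1 := hchain j t ht
  have h2 : x ^ (γ / 2) * Real.exp (-γ) * b t * (q / 2) ≤
      Real.exp (γ / 2) ^ j * b t * (q / 2) := by gcongr
  linarith

/-- For a negative index, the increments of the tail quantile function are bounded on the scale
`a₀`. -/
lemma SecondOrderCondition.increment_upper {U : ℝ → ℝ} {γ ρ : ℝ} {a A₀ : ℝ → ℝ}
    (h : SecondOrderCondition U γ ρ a A₀) (hU : MonotoneOn U (Set.Ioi 1)) (hγ : γ < 0) :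
    ∃ C T, 0 ≤ C ∧ ∀ t, T ≤ t → ∀ x, 1 ≤ x →
      U (t * x) - U t ≤ C * scaleZero γ ρ a A₀ t := by
  have hr := h.scaleZero_ratio hγ.ne
  have hfo := h.first_order (Real.exp_pos 1)
  have hpos := h.scaleZero_pos
  set b := scaleZero γ ρ a A₀
  have hp : 0 < powerQuot γ (Real.exp 1) := powerQuot_pos (by simp)
  set q := powerQuot γ (Real.exp 1)
  obtain ⟨T, hT⟩ := eventually_atTop.1 (hpos.and
    ((hr.eventually (gt_mem_nhds (Real.exp_lt_exp.2 (show γ < γ / 2 by linarith)))).and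
      (hfo.eventually (gt_mem_nhds (show q < 2 * q by linarith)))))
  have he : (1 : ℝ) ≤ Real.exp 1 := Real.one_le_exp (by norm_num)
  have hθ : Real.exp (γ / 2) < 1 := by simpa [Real.exp_lt_one_iff] using (show γ / 2 < 0 by linarith)
  set θ := Real.exp (γ / 2)
  have hθ' : 0 < 1 - θ := by linarith
  have hchain : ∀ j : ℕ, ∀ t, max T 2 ≤ t →
      U (t * Real.exp 1 ^ j) - U t ≤ 2 * q / (1 - θ) * b t := by
    intro j
    induction j with
    | zero =>
      intro t ht
      have h1 := (hT t ((le_max_left _ _).trans ht)).1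
      simp only [pow_zero, mul_one, sub_self]
      positivity
    | succ j ih =>
      intro t ht
      obtain ⟨h1, h2, h3⟩ := hT t ((le_max_left _ _).trans ht)
      have ht2 : 2 ≤ t := (le_max_right _ _).trans ht
      have h4 := ih (t * Real.exp 1) (ht.trans (le_mul_of_one_le_right (by linarith) he))
      rw [div_lt_iff₀ h1] at h2 h3
      rw [mul_assoc t, ← pow_succ'] at h4
      have h5 : 2 * q / (1 - θ) * b (t * Real.exp 1) ≤ 2 * q / (1 - θ) * (θ * b t) := by
        gcongr
      have h6 : 2 * q / (1 - θ) * (θ * b t) + 2 * q * b t = 2 * q / (1 - θ) * b t := by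
        field_simp
        ring
      linarith
  refine ⟨2 * q / (1 - θ), max T 2, by positivity, fun t ht x hx => ?_⟩
  have ht2 : 2 ≤ t := (le_max_right _ _).trans ht
  have hxj : x ≤ Real.exp 1 ^ ⌈Real.log x⌉₊ := by
    rw [← Real.exp_nat_mul, mul_one, ← Real.log_le_iff_le_exp (by linarith)]
    exact Nat.le_ceil _
  have hmono : U (t * x) ≤ U (t * Real.exp 1 ^ ⌈Real.log x⌉₊) := by
    refine hU ?_ ?_ (by gcongr)
    · simp only [Set.mem_Ioi]; nlinarith
    · simp only [Set.mem_Ioi]; nlinarith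
  linarith [hchain ⌈Real.log x⌉₊ t ht]

lemma powerQuot_exp_continuous (c : ℝ) : Continuous fun s => powerQuot c (Real.exp s) := by
  unfold powerQuot
  split_ifs
  · simp only [Real.log_exp]
    exact continuous_id
  · simp_rw [← Real.exp_mul]
    fun_prop

lemma secondOrderLimit_zero_exp_continuous (ρ : ℝ) :
    Continuous fun s => secondOrderLimit 0 ρ (Real.exp s) := by
  unfold secondOrderLimit
  split_ifs
  · exact powerQuot_exp_continuous _
  · simp at *
  · simp only [Real.log_exp]
    fun_prop

/-- For index zero, the increments of the tail quantile function are logarithmic up to an error of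
the order of the rate function, uniformly near `1`, and up to an arbitrarily small power of the
argument (here `x ^ (1 / 4)`) for all `x ≥ 1`. -/
lemma SecondOrderCondition.increment_log {U : ℝ → ℝ} {ρ : ℝ} {a A₀ : ℝ → ℝ}
    (h : SecondOrderCondition U 0 ρ a A₀) (hU : MonotoneOn U (Set.Ioi 1)) :
    ∃ C T, 0 ≤ C ∧ ∀ t, T ≤ t →
      (∀ x ∈ Set.Icc (1 / 4 : ℝ) 4, |U (t * x) - U t - scaleZero 0 ρ a A₀ t * Real.log x| ≤
        C * (scaleZero 0 ρ a A₀ t * |A₀ t|)) ∧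
      (∀ x, 1 ≤ x → |U (t * x) - U t - scaleZero 0 ρ a A₀ t * Real.log x| ≤
        C * x ^ (1 / 4 : ℝ) * (scaleZero 0 ρ a A₀ t * |A₀ t|)) := by
  have hb := h.scaleZero_pos
  set b := scaleZero 0 ρ a A₀ with hbdef
  -- `U` is monotone only on `(1, ∞)`, so its logarithmic version is truncated at `1`
  set H : ℝ → ℝ := fun u => U (Real.exp (max u 1)) with hHdef
  set β : ℝ → ℝ := fun u => b (Real.exp u) with hβdef
  set α : ℝ → ℝ := fun u => |A₀ (Real.exp u)| with hαdef
  set φ : ℝ → ℝ := fun s => |secondOrderLimit 0 ρ (Real.exp s)| + 1 with hφdef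
  have hexp : ∀ {p : ℝ → Prop}, (∀ᶠ t in atTop, p t) → ∀ᶠ u in atTop, p (Real.exp u) :=
    fun hp => Real.tendsto_exp_atTop.eventually hp
  have hHmono : Monotone H := by
    intro u v huv
    have hmem : ∀ w : ℝ, Real.exp (max w 1) ∈ Set.Ioi (1 : ℝ) := fun w => by
      simp only [Set.mem_Ioi, Real.one_lt_exp_iff]
      exact zero_lt_one.trans_le (le_max_right _ _)
    exact hU (hmem u) (hmem v) (Real.exp_le_exp.2 (max_le_max_right 1 huv))
  have hHeq : ∀ u, 1 ≤ u → H u = U (Real.exp u) := fun u hu => by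
    simp only [hHdef, max_eq_left hu]
  have hα0 : ∀ u, 0 ≤ α u := fun u => abs_nonneg _
  have hαlim : Tendsto α atTop (𝓝 0) := by
    have := (h.rate_tendsto.comp Real.tendsto_exp_atTop).abs
    simpa using this
  have hne := hexp h.rate_ne_zero
  have hβpos : ∀ᶠ u in atTop, 0 < β u := hexp hb
  have hrem : ∀ s, ∀ᶠ u in atTop, |H (u + s) - H u - β u * s| ≤ φ s * (β u * α u) := by
    intro s
    have h1 := ((h.second_order (Real.exp s) (Real.exp_pos s)).comp
      Real.tendsto_exp_atTop).abs
    have h2 := h1.eventually (gt_mem_nhds (lt_add_one _))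
    filter_upwards [h2, hne, hexp hb, eventually_ge_atTop (1 : ℝ), eventually_ge_atTop (1 - s)]
      with u h2 hA hbu hu1 hu2
    simp only [Function.comp] at h2
    rw [hHeq _ hu1, hHeq _ (by linarith), Real.exp_add]
    have hbu' : 0 < β u := hbu
    have hα1 : 0 < α u := abs_pos.2 hA
    rw [abs_div, div_lt_iff₀ hα1] at h2
    simp only [powerQuot, if_true, Real.log_exp] at h2
    change |(U (Real.exp u * Real.exp s) - U (Real.exp u)) / β u - s| < φ s * α u at h2
    have h3 : U (Real.exp u * Real.exp s) - U (Real.exp u) - β u * s =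
        β u * ((U (Real.exp u * Real.exp s) - U (Real.exp u)) / β u - s) := by
      field_simp
    rw [h3, abs_mul, abs_of_pos hbu']
    calc β u * |(U (Real.exp u * Real.exp s) - U (Real.exp u)) / β u - s|
        ≤ β u * (φ s * α u) := by gcongr
      _ = _ := by ring
  have hreg : ∀ s, Tendsto (fun u => α (u + s) / α u) atTop (𝓝 (Real.exp (ρ * s))) := by
    intro s
    have h1 := (h.rate_regular (Real.exp s) (Real.exp_pos s)).comp Real.tendsto_exp_atTop
    rw [← Real.exp_mul, mul_comm s] at h1
    refine h1.congr fun u => ?_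
    simp only [Function.comp, hαdef, Real.exp_add]
  have hup : ∀ s, ∀ᶠ u in atTop, α (u + s) ≤ (Real.exp (ρ * s) + 1) * α u := by
    intro s
    filter_upwards [(hreg s).eventually (gt_mem_nhds (lt_add_one _)), hne] with u h1 h2
    have hα1 : 0 < α u := abs_pos.2 h2
    exact ((div_lt_iff₀ hα1).1 h1).le
  have hlow : ∀ s, ∀ᶠ u in atTop, α u ≤ (Real.exp (-(ρ * s)) + 1) * α (u + s) := by
    intro s
    have h1 := (hreg s).inv₀ (Real.exp_pos _).ne'
    rw [← Real.exp_neg] at h1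
    filter_upwards [h1.eventually (gt_mem_nhds (lt_add_one _)),
      (tendsto_atTop_add_const_right atTop s tendsto_id).eventually hne] with u h1 h2
    have hα1 : 0 < α (u + s) := abs_pos.2 h2
    rw [inv_div] at h1
    exact ((div_lt_iff₀ hα1).1 h1).le
  have hαmeas : Measurable α := (h.measurable_rate.comp Real.measurable_exp).abs
  have hφcont : Continuous φ := (secondOrderLimit_zero_exp_continuous ρ).abs.add continuous_const
  obtain ⟨C, T₁, hC, hunif⟩ := uniform_remainder hHmono hβpos hαmeas hα0 hαlim hφcont
    hrem hup hlow
  have hαstep : ∀ᶠ u in atTop, α (u + 1) ≤ Real.exp (1 / 4) * α u := by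
    have : Real.exp (ρ * 1) < Real.exp (1 / 4) :=
      Real.exp_lt_exp.2 (by have := h.rho_nonpos; linarith)
    filter_upwards [(hreg 1).eventually (gt_mem_nhds this), hne] with u h1 h2
    exact ((div_lt_iff₀ (abs_pos.2 h2)).1 h1).le
  have hsmall : ∀ᶠ u in atTop, 6 * C * α u ≤ 1 / 8 := by
    have : Tendsto (fun u => 6 * C * α u) atTop (𝓝 (6 * C * 0)) := hαlim.const_mul _
    rw [mul_zero] at this
    exact this.eventually (Iic_mem_nhds (by norm_num))
  obtain ⟨T₂, hT₂⟩ := eventually_atTop.1 ((hexp hb).and (hαstep.and hsmall))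
  set T := max T₁ (max T₂ 3) with hTdef
  have hT₁ : T₁ ≤ T := le_max_left _ _
  have hT₂' : T₂ ≤ T := (le_max_left _ _).trans (le_max_right _ _)
  have hT3 : 3 ≤ T := (le_max_right _ _).trans (le_max_right _ _)
  -- the increment over two unit steps, computed in two ways, compares `β (u + 1)` with `β u`
  have hscale : ∀ u, T ≤ u → |β (u + 1) - β u| ≤ 6 * C * (β u * α u) := by
    intro u hu
    obtain ⟨hβ, hstep, hsm⟩ := hT₂ u (by linarith)
    obtain ⟨hβ', -, hsm'⟩ := hT₂ (u + 1) (by linarith)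
    have h1 := hunif u (by linarith) 1 (by norm_num)
    have h2 := hunif u (by linarith) 2 (by norm_num)
    have h3 := hunif (u + 1) (by linarith) 1 (by norm_num)
    have e1 : u + 1 + 1 = u + 2 := by ring
    rw [e1] at h3
    have hβu : 0 < β u := hβ
    have hβu' : 0 < β (u + 1) := hβ'
    have hq : Real.exp (1 / 4) ≤ 3 / 2 := by
      have := Real.abs_exp_sub_one_le (x := 1 / 4) (by norm_num [abs_of_pos])
      rw [abs_of_pos (by norm_num : (0 : ℝ) < 1 / 4)] at this
      have := (abs_le.1 this).2
      linarith
    have h4 : α (u + 1) ≤ 3 / 2 * α u := hstep.trans (by gcongr)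
    have h5 : β (u + 1) * (C * α (u + 1)) ≤ β (u + 1) * (1 / 48) := by
      gcongr
      linarith
    have h6 : β u * (C * α u) ≤ β u * (1 / 48) := by
      gcongr
      linarith
    rw [abs_le] at h1 h2 h3
    have h7 : β (u + 1) ≤ 4 / 3 * β u := by linarith
    have h8 : C * (β (u + 1) * α (u + 1)) ≤ C * ((4 / 3 * β u) * (3 / 2 * α u)) := by
      gcongr
    have h9 : 0 ≤ C * (β u * α u) := mul_nonneg hC (mul_nonneg hβu.le (hα0 u))
    rw [abs_le]
    constructor <;> linarith
  have hgrow := remainder_growth (H := H) (β := β) (α := α) (C := 6 * C) (T := T)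
    (by positivity) hα0 (fun u hu => (hT₂ u (by linarith)).1)
    (fun u hu v hv => (hunif u (by linarith) v
      ⟨by linarith [hv.1], by linarith [hv.2]⟩).trans (by
        have : 0 ≤ C * (β u * α u) :=
          mul_nonneg hC (mul_nonneg (hT₂ u (by linarith)).1.le (hα0 u))
        linarith))
    hscale (fun u hu => (hT₂ u (by linarith)).2.1) (fun u hu => (hT₂ u (by linarith)).2.2)
  refine ⟨50 * (6 * C), Real.exp T, by positivity, fun t ht => ?_⟩
  have ht0 : 0 < t := (Real.exp_pos T).trans_le ht
  have hlt : T ≤ Real.log t := (Real.le_log_iff_exp_le ht0).2 ht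
  have ebt : β (Real.log t) = b t := by simp only [hβdef, Real.exp_log ht0]
  have eAt : α (Real.log t) = |A₀ t| := by simp only [hαdef, Real.exp_log ht0]
  have eHt : H (Real.log t) = U t := by
    rw [hHeq _ (by linarith), Real.exp_log ht0]
  have hnn : 0 ≤ b t * |A₀ t| := by
    rw [← ebt]
    exact mul_nonneg (hT₂ _ (by linarith)).1.le (abs_nonneg _)
  have eHx : ∀ x, 0 < x → -2 ≤ Real.log x → H (Real.log t + Real.log x) = U (t * x) := by
    intro x hx hlx
    rw [hHeq _ (by linarith), Real.exp_add, Real.exp_log ht0, Real.exp_log hx]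
  have hlog4 : Real.log 4 ≤ 2 := by
    have : (4 : ℝ) = 2 * 2 := by norm_num
    rw [this, Real.log_mul (by norm_num) (by norm_num)]
    have := Real.log_two_lt_d9
    linarith
  constructor
  · intro x hx
    have hx0 : 0 < x := lt_of_lt_of_le (by norm_num) hx.1
    have hl1 : Real.log x ≤ 2 := (Real.log_le_log hx0 hx.2).trans hlog4
    have hl2 : -2 ≤ Real.log x := by
      have := Real.log_le_log (by norm_num) hx.1
      rw [one_div, Real.log_inv] at this
      linarith
    have h1 := hunif (Real.log t) (by linarith) (Real.log x) ⟨hl2, hl1⟩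
    rw [ebt, eAt, eHt, eHx x hx0 hl2] at h1
    refine h1.trans ?_
    gcongr
    linarith
  · intro x hx
    have hx0 : 0 < x := by linarith
    have hl : 0 ≤ Real.log x := Real.log_nonneg hx
    have h1 := hgrow (Real.log t) hlt (Real.log x) hl
    rw [ebt, eAt, eHt, eHx x hx0 (by linarith)] at h1
    have e : x ^ (1 / 4 : ℝ) = Real.exp (Real.log x / 4) := by
      rw [Real.rpow_def_of_pos hx0]
      congr 1
      ring
    rw [e]
    exact h1

/-! ### Quantiles -/

section Quantile

variable {μ : Measure ℝ}

lemma bddBelow_le_cdf {p : ℝ} (hp : 0 < p) : BddBelow {x : ℝ | p ≤ cdf μ x} := by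
  obtain ⟨y, hy⟩ := ((tendsto_cdf_atBot μ).eventually (gt_mem_nhds hp)).exists
  refine ⟨y, fun x hx => ?_⟩
  by_contra! hlt
  exact absurd (hx.trans (monotone_cdf μ hlt.le)) (not_le.2 hy)

lemma level_pos {t : ℝ} (ht : 1 < t) : 0 < 1 - 1 / t := by
  have : 1 / t < 1 := by rw [div_lt_one (by linarith)]; exact ht
  linarith

lemma tailQuantile_le {t x : ℝ} (ht : 1 < t) (hx : 1 - 1 / t ≤ cdf μ x) :
    tailQuantile (cdf μ) t ≤ x :=
  csInf_le (bddBelow_le_cdf (level_pos ht)) hx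

lemma le_cdf_tailQuantile {t : ℝ} (ht : 1 < t) :
    1 - 1 / t ≤ cdf μ (tailQuantile (cdf μ) t) := by
  have hlt : 1 - 1 / t < 1 := by
    have : 0 < 1 / t := by positivity
    linarith
  have hne : {x : ℝ | 1 - 1 / t ≤ cdf μ x}.Nonempty := by
    obtain ⟨y, hy⟩ := ((tendsto_cdf_atTop μ).eventually (lt_mem_nhds hlt)).exists
    exact ⟨y, hy.le⟩
  have hcont : Tendsto (cdf μ) (𝓝[>] (tailQuantile (cdf μ) t))
      (𝓝 (cdf μ (tailQuantile (cdf μ) t))) :=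
    ((cdf μ).right_continuous _).mono_left (nhdsWithin_mono _ Set.Ioi_subset_Ici_self)
  refine ge_of_tendsto hcont ?_
  filter_upwards [self_mem_nhdsWithin] with y hy
  obtain ⟨x, hx, hxy⟩ := exists_lt_of_csInf_lt hne hy
  exact hx.trans (monotone_cdf μ hxy.le)

lemma tailQuantile_le_iff {t x : ℝ} (ht : 1 < t) :
    tailQuantile (cdf μ) t ≤ x ↔ 1 - 1 / t ≤ cdf μ x :=
  ⟨fun h => (le_cdf_tailQuantile ht).trans (monotone_cdf μ h), tailQuantile_le ht⟩

lemma monotoneOn_tailQuantile : MonotoneOn (tailQuantile (cdf μ)) (Set.Ioi 1) := by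
  intro s hs t ht hst
  have hs0 : (0 : ℝ) < s := zero_lt_one.trans hs
  refine tailQuantile_le hs (le_trans ?_ (le_cdf_tailQuantile ht))
  have : 1 / t ≤ 1 / s := one_div_le_one_div_of_le hs0 hst
  linarith

variable [IsProbabilityMeasure μ]

lemma measureReal_Ioi_tailQuantile_le {t : ℝ} (ht : 1 < t) :
    μ.real (Set.Ioi (tailQuantile (cdf μ) t)) ≤ 1 / t := by
  have h := le_cdf_tailQuantile (μ := μ) ht
  rw [cdf_eq_real] at h
  rw [← Set.compl_Iic, probReal_compl_eq_one_sub measurableSet_Iic]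
  linarith

lemma measureReal_Iio_tailQuantile_le {t : ℝ} (ht : 1 < t) :
    μ.real (Set.Iio (tailQuantile (cdf μ) t)) ≤ 1 - 1 / t := by
  have h1 : Function.leftLim (cdf μ) (tailQuantile (cdf μ) t) ≤ 1 - 1 / t := by
    refine le_of_tendsto ((monotone_cdf μ).tendsto_leftLim _) ?_
    filter_upwards [self_mem_nhdsWithin] with y hy
    by_contra! hlt
    exact absurd (tailQuantile_le ht hlt.le) (not_le.2 hy)
  have h2 := (cdf μ).measure_Iio (tendsto_cdf_atBot μ) (tailQuantile (cdf μ) t)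
  rw [measure_cdf, sub_zero] at h2
  rw [Measure.real, h2]
  exact (ENNReal.toReal_mono ENNReal.ofReal_ne_top (ENNReal.ofReal_le_ofReal h1)).trans_eq
    (ENNReal.toReal_ofReal (level_pos ht).le)

end Quantile

/-! ### Order statistics and counts -/

/-- The number of `i < n` with `X i ω ∈ B`, as a real number. -/
def sampleCount {Ω : Type*} (X : ℕ → Ω → ℝ) (n : ℕ) (B : Set ℝ) (ω : Ω) : ℝ :=
  ∑ i ∈ Finset.range n, B.indicator (fun _ => (1 : ℝ)) (X i ω)

section OrderStat

variable {Ω : Type*} {X : ℕ → Ω → ℝ} {n : ℕ} {ω : Ω}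

lemma sampleCount_compl (B : Set ℝ) : sampleCount X n Bᶜ ω = n - sampleCount X n B ω := by
  rw [sampleCount, sampleCount, eq_sub_iff_add_eq, ← Finset.sum_add_distrib]
  have : ∀ x : ℝ, Bᶜ.indicator (fun _ => (1 : ℝ)) x + B.indicator (fun _ => (1 : ℝ)) x = 1 :=
    fun x => congrFun (Set.indicator_compl_add_self B (fun _ => (1 : ℝ))) x
  simp [this]

lemma card_sort_filter_eq_sampleCount (B : Set ℝ) [DecidablePred (· ∈ B)] :
    ((Finset.univ.filter fun i : Fin n =>
      ((fun i : Fin n => X i ω) ∘ Tuple.sort (fun i : Fin n => X i ω)) i ∈ B).card : ℝ) =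
    sampleCount X n B ω := by
  rw [Finset.card_filter, sampleCount]
  push_cast
  simp only [Function.comp]
  rw [Equiv.sum_comp (Tuple.sort fun i : Fin n => X i ω)
    (fun i : Fin n => if X i ω ∈ B then (1 : ℝ) else 0),
    Fin.sum_univ_eq_sum_range (fun i => if X i ω ∈ B then (1 : ℝ) else 0)]
  simp [Set.indicator_apply]

lemma orderStat_le_iff {j : ℕ} (hj : 1 ≤ j) (hjn : j ≤ n) (u : ℝ) :
    orderStat X j n ω ≤ u ↔ (j : ℝ) ≤ sampleCount X n (Set.Iic u) ω := by
  classical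
  rw [orderStat, dif_pos ⟨hj, hjn⟩, ← card_sort_filter_eq_sampleCount, Nat.cast_le]
  have h := Tuple.lt_card_le_iff_apply_le_of_monotone (j := ⟨j - 1, by omega⟩) (a := u)
    (Tuple.monotone_sort fun i : Fin n => X i ω)
  simp only [Function.comp, Set.mem_Iic] at h ⊢
  rw [← h]
  change j - 1 < _ ↔ _
  omega

lemma orderStat_lt_iff {j : ℕ} (hj : 1 ≤ j) (hjn : j ≤ n) (u : ℝ) :
    orderStat X j n ω < u ↔ (j : ℝ) ≤ sampleCount X n (Set.Iio u) ω := by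
  classical
  rw [orderStat, dif_pos ⟨hj, hjn⟩, ← card_sort_filter_eq_sampleCount, Nat.cast_le]
  have h := Tuple.lt_card_lt_iff_apply_lt_of_monotone (j := ⟨j - 1, by omega⟩) (a := u)
    (Tuple.monotone_sort fun i : Fin n => X i ω)
  simp only [Function.comp, Set.mem_Iio] at h ⊢
  rw [← h]
  change j - 1 < _ ↔ _
  omega

lemma orderStat_mono {i j : ℕ} (hi : 1 ≤ i) (hij : i ≤ j) (hjn : j ≤ n) :
    orderStat X i n ω ≤ orderStat X j n ω := by
  rw [orderStat, orderStat, dif_pos ⟨hi, hij.trans hjn⟩, dif_pos ⟨hi.trans hij, hjn⟩]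
  exact Tuple.monotone_sort (fun i : Fin n => X i ω) (Fin.mk_le_mk.2 (by omega))

lemma orderStat_top_le_iff (hn : 1 ≤ n) (u : ℝ) :
    orderStat X n n ω ≤ u ↔ ∀ i < n, X i ω ≤ u := by
  constructor
  · intro h i hi
    refine le_trans ?_ h
    have hle := orderStat_mono (X := X) (ω := ω) (n := n)
      (i := ((Tuple.sort fun i : Fin n => X i ω).symm ⟨i, hi⟩ : ℕ) + 1) (j := n)
      (by omega) (by omega) le_rfl
    refine le_trans (le_of_eq ?_) hle
    rw [orderStat, dif_pos ⟨by omega, by omega⟩]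
    simp
  · intro h
    rw [orderStat, dif_pos ⟨hn, le_rfl⟩]
    exact h _ (Fin.is_lt _)

lemma le_orderStat_top {i : ℕ} (hi : i < n) : X i ω ≤ orderStat X n n ω :=
  (orderStat_top_le_iff (by omega) _).1 le_rfl i hi

end OrderStat

section Probability

variable {Ω : Type*} [MeasurableSpace Ω] {P : Measure Ω} {μ : Measure ℝ} {X : ℕ → Ω → ℝ}

lemma measurable_sampleCount (hX : ∀ i, Measurable (X i)) (n : ℕ) {B : Set ℝ}
    (hB : MeasurableSet B) : Measurable (sampleCount X n B) := by
  unfold sampleCount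
  exact Finset.measurable_sum _ fun i _ => (measurable_const.indicator hB).comp (hX i)

lemma measurable_orderStat (hX : ∀ i, Measurable (X i)) (j n : ℕ) :
    Measurable (orderStat X j n) := by
  by_cases h : 1 ≤ j ∧ j ≤ n
  · refine measurable_of_Iic fun u => ?_
    have : orderStat X j n ⁻¹' Set.Iic u = {ω | (j : ℝ) ≤ sampleCount X n (Set.Iic u) ω} := by
      ext ω
      exact orderStat_le_iff h.1 h.2 u
    rw [this]
    exact measurableSet_le measurable_const (measurable_sampleCount hX n measurableSet_Iic)
  · have : orderStat X j n = fun _ => 0 := by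
      funext ω
      rw [orderStat, dif_neg h]
    rw [this]
    exact measurable_const

lemma measurable_testStatStar (hX : ∀ i, Measurable (X i)) (k n : ℕ) :
    Measurable (testStatStar X k n) := by
  have h := fun j => measurable_orderStat hX j n
  unfold testStatStar testStat endpointEstimator
  fun_prop

lemma measureReal_preimage (hX : ∀ i, Measurable (X i)) (hlaw : ∀ i, P.map (X i) = μ) (i : ℕ)
    {B : Set ℝ} (hB : MeasurableSet B) : P.real (X i ⁻¹' B) = μ.real B := by
  rw [← hlaw i, map_measureReal_apply (hX i) hB]

lemma measureReal_forall_mem (hX : ∀ i, Measurable (X i)) (hindep : iIndepFun X P)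
    (hlaw : ∀ i, P.map (X i) = μ) (n : ℕ) {B : Set ℝ} (hB : MeasurableSet B) :
    P.real {ω | ∀ i < n, X i ω ∈ B} = μ.real B ^ n := by
  have h := hindep.measure_inter_preimage_eq_mul (Finset.range n) (sets := fun _ => B)
    (fun _ _ => hB)
  have hset : {ω | ∀ i < n, X i ω ∈ B} = ⋂ i ∈ Finset.range n, X i ⁻¹' B := by
    ext ω
    simp
  rw [hset, Measure.real, h, ENNReal.toReal_prod]
  have : ∀ i, (P (X i ⁻¹' B)).toReal = μ.real B := fun i => measureReal_preimage hX hlaw i hB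
  simp [this]

variable [IsProbabilityMeasure P]

/-- Chebyshev's inequality for the binomial number of observations in `B`. -/
lemma measureReal_sampleCount_deviation (hX : ∀ i, Measurable (X i)) (hindep : iIndepFun X P)
    (hlaw : ∀ i, P.map (X i) = μ) (n : ℕ) {B : Set ℝ} (hB : MeasurableSet B) {c : ℝ}
    (hc : 0 < c) :
    P.real {ω | c ≤ |sampleCount X n B ω - n * μ.real B|} ≤ n * μ.real B / c ^ 2 := by
  set Y : ℕ → Ω → ℝ := fun i ω => B.indicator (fun _ => (1 : ℝ)) (X i ω) with hY
  have hφ : Measurable (B.indicator (fun _ => (1 : ℝ))) := measurable_const.indicator hB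
  have hYm : ∀ i, Measurable (Y i) := fun i => hφ.comp (hX i)
  have hYb : ∀ i ω, Y i ω ∈ Set.Icc (0 : ℝ) 1 := by
    intro i ω
    by_cases h : X i ω ∈ B <;> simp [hY, h]
  have hYL : ∀ i, MemLp (Y i) 2 P := fun i =>
    memLp_of_bounded (ae_of_all _ (hYb i)) (hYm i).aestronglyMeasurable 2
  have hYi : iIndepFun Y P := hindep.comp (fun _ => B.indicator (fun _ => (1 : ℝ))) fun _ => hφ
  have hmean : ∀ i, ∫ ω, Y i ω ∂P = μ.real B := by
    intro i
    have : Y i = (X i ⁻¹' B).indicator (fun _ => (1 : ℝ)) := by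
      funext ω
      by_cases h : X i ω ∈ B <;> simp [hY, h]
    rw [this, integral_indicator_const _ (hX i hB), smul_eq_mul, mul_one,
      measureReal_preimage hX hlaw i hB]
  have hvar : ∀ i, variance (Y i) P ≤ μ.real B := by
    intro i
    have h := variance_le_sub_mul_sub (ae_of_all P (hYb i)) (hYm i).aemeasurable
    rw [hmean i] at h
    nlinarith [sq_nonneg (μ.real B)]
  have hsum : sampleCount X n B = ∑ i ∈ Finset.range n, Y i := by
    funext ω
    simp [sampleCount, hY]
  have hSL : MemLp (sampleCount X n B) 2 P := by
    rw [hsum]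
    exact memLp_finsetSum' _ fun i _ => hYL i
  have hSmean : ∫ ω, sampleCount X n B ω ∂P = n * μ.real B := by
    unfold sampleCount
    rw [integral_finsetSum _ fun i _ => (hYL i).integrable (by norm_num)]
    exact (Finset.sum_congr rfl fun i _ => hmean i).trans (by simp)
  have hSvar : variance (sampleCount X n B) P ≤ n * μ.real B := by
    rw [hsum, IndepFun.variance_sum (fun i _ => hYL i) fun i _ j _ hij => hYi.indepFun hij]
    calc ∑ i ∈ Finset.range n, variance (Y i) P ≤ ∑ i ∈ Finset.range n, μ.real B :=
          Finset.sum_le_sum fun i _ => hvar i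
      _ = _ := by simp
  have h := meas_ge_le_variance_div_sq hSL hc
  rw [hSmean] at h
  rw [Measure.real]
  refine (ENNReal.toReal_le_of_le_ofReal (by have := variance_nonneg (sampleCount X n B) P; positivity) h).trans ?_
  gcongr

variable [IsProbabilityMeasure μ]

/-- An intermediate order statistic lies, with high probability, between the tail quantiles whose
levels are off by a relative amount `δ`. -/
lemma measureReal_not_orderStat_mem (hX : ∀ i, Measurable (X i)) (hindep : iIndepFun X P)
    (hlaw : ∀ i, P.map (X i) = μ) {n m : ℕ} (hm : 1 ≤ m) {δ : ℝ} (hδ : 0 < δ)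
    (hδ1 : δ < 1) (hmn : m * (1 + δ) < n) :
    P.real {ω | ¬ (tailQuantile (cdf μ) (n / (m * (1 + δ))) ≤ orderStat X (n - m) n ω ∧
      orderStat X (n - m) n ω ≤ tailQuantile (cdf μ) (n / (m * (1 - δ))))} ≤
      3 / (δ ^ 2 * m) := by
  have hm0 : (0 : ℝ) < m := by exact_mod_cast hm
  have hn0 : (0 : ℝ) < n := by nlinarith
  have hmn' : m < n := by
    have : (m : ℝ) < n := by nlinarith
    exact_mod_cast this
  have hd1 : 0 < m * (1 - δ) := mul_pos hm0 (by linarith)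
  have hd2 : 0 < m * (1 + δ) := mul_pos hm0 (by linarith)
  have ht1 : 1 < n / (m * (1 - δ)) := by rw [one_lt_div hd1]; nlinarith
  have ht2 : 1 < n / (m * (1 + δ)) := by rw [one_lt_div hd2]; exact hmn
  set u₁ := tailQuantile (cdf μ) (n / (m * (1 - δ)))
  set u₂ := tailQuantile (cdf μ) (n / (m * (1 + δ)))
  have hcast : ((n - m : ℕ) : ℝ) = n - m := by push_cast [hmn'.le]; ring
  -- the order statistic is too large: too many observations above `u₁`
  have hup : P.real {ω | u₁ < orderStat X (n - m) n ω} ≤ 1 / (δ ^ 2 * m) := by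
    have hp : n * μ.real (Set.Ioi u₁) ≤ m * (1 - δ) := by
      have := measureReal_Ioi_tailQuantile_le (μ := μ) ht1
      rw [one_div_div, le_div_iff₀ hn0] at this
      linarith
    have hsub : {ω | u₁ < orderStat X (n - m) n ω} ⊆
        {ω | δ * m ≤ |sampleCount X n (Set.Ioi u₁) ω - n * μ.real (Set.Ioi u₁)|} := by
      intro ω hω
      have h1 := (orderStat_le_iff (X := X) (ω := ω) (n := n) (j := n - m) (by omega) (by omega)
        u₁).not.1 (not_le.2 hω)
      rw [not_le, hcast] at h1
      have h2 := sampleCount_compl (X := X) (n := n) (ω := ω) (Set.Iic u₁)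
      rw [Set.compl_Iic] at h2
      change δ * m ≤ |sampleCount X n (Set.Ioi u₁) ω - n * μ.real (Set.Ioi u₁)|
      refine le_trans ?_ (le_abs_self _)
      linarith
    refine (measureReal_mono hsub).trans ((measureReal_sampleCount_deviation hX hindep hlaw n
      measurableSet_Ioi (by positivity)).trans ?_)
    calc n * μ.real (Set.Ioi u₁) / (δ * m) ^ 2 ≤ m / (δ * m) ^ 2 := by
          gcongr
          nlinarith
      _ = 1 / (δ ^ 2 * m) := by field_simp
  -- the order statistic is too small: too few observations above `u₂`
  have hlow : P.real {ω | orderStat X (n - m) n ω < u₂} ≤ 2 / (δ ^ 2 * m) := by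
    set q := n * μ.real (Set.Ici u₂) with hq
    have hp : m * (1 + δ) ≤ q := by
      have h1 := measureReal_Iio_tailQuantile_le (μ := μ) ht2
      rw [← Set.compl_Ici, probReal_compl_eq_one_sub measurableSet_Ici, one_div_div] at h1
      have h2 : m * (1 + δ) / n ≤ μ.real (Set.Ici u₂) := by linarith
      rw [div_le_iff₀ hn0] at h2
      linarith
    have hsub : {ω | orderStat X (n - m) n ω < u₂} ⊆
        {ω | q - m ≤ |sampleCount X n (Set.Ici u₂) ω - q|} := by
      intro ω hω
      have h1 := (orderStat_lt_iff (X := X) (ω := ω) (n := n) (j := n - m) (by omega) (by omega)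
        u₂).1 hω
      rw [hcast] at h1
      have h2 := sampleCount_compl (X := X) (n := n) (ω := ω) (Set.Ici u₂)
      rw [Set.compl_Ici] at h2
      change q - m ≤ |sampleCount X n (Set.Ici u₂) ω - q|
      refine le_trans ?_ (neg_le_abs _)
      linarith
    have hqm : 0 < q - m := by nlinarith
    refine (measureReal_mono hsub).trans ((measureReal_sampleCount_deviation hX hindep hlaw n
      measurableSet_Ici hqm).trans ?_)
    rw [← hq, div_le_div_iff₀ (by positivity) (by positivity)]
    have h3 : 0 ≤ q - m * (1 + δ) := by linarith
    have h4 : δ * q ≤ (1 + δ) * (q - m) := by nlinarith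
    have h5 : δ * m ≤ q - m := by nlinarith
    calc q * (δ ^ 2 * m) = (δ * q) * (δ * m) := by ring
      _ ≤ ((1 + δ) * (q - m)) * (q - m) := by gcongr
      _ ≤ (2 * (q - m)) * (q - m) := by gcongr; linarith
      _ = _ := by ring
  have hsub : {ω | ¬ (u₂ ≤ orderStat X (n - m) n ω ∧ orderStat X (n - m) n ω ≤ u₁)} ⊆
      {ω | u₁ < orderStat X (n - m) n ω} ∪ {ω | orderStat X (n - m) n ω < u₂} := by
    intro ω hω
    simp only [Set.mem_ofPred_eq, Set.mem_union, not_and_or, not_le] at hω ⊢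
    exact hω.symm
  refine (measureReal_mono hsub).trans ((measureReal_union_le _ _).trans ?_)
  calc _ ≤ 1 / (δ ^ 2 * m) + 2 / (δ ^ 2 * m) := add_le_add hup hlow
    _ = _ := by ring

end Probability

/-! ### Convergence in distribution from distribution functions -/

/-- Pointwise convergence of distribution functions to a distribution function implies convergence in distribution. -/
lemma tendstoInDistribution_of_tendsto_cdf {Ω : Type*} [MeasurableSpace Ω] {P : Measure Ω}
    [IsProbabilityMeasure P] {ν : Measure ℝ} [IsProbabilityMeasure ν] {V : ℕ → Ω → ℝ}
    (hV : ∀ n, Measurable (V n))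
    (h : ∀ z, Tendsto (fun n => P.real {ω | V n ω ≤ z}) atTop (𝓝 (cdf ν z))) :
    TendstoInDistribution V atTop (fun z : ℝ => z) (fun _ => P) ν := by
  refine ⟨fun n => (hV n).aemeasurable, aemeasurable_id, ?_⟩
  refine IsPiSystem.tendsto_probabilityMeasure_of_tendsto_of_mem
    (S := {s | ∃ a b : ℝ, a < b ∧ Set.Ioc a b = s}) ?_ ?_ ?_ ?_
  · rintro _ ⟨a, b, hab, rfl⟩ _ ⟨c, d, hcd, rfl⟩ hne
    rw [Set.Ioc_inter_Ioc] at hne ⊢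
    exact ⟨_, _, Set.nonempty_Ioc.1 hne, rfl⟩
  · rintro _ ⟨a, b, -, rfl⟩
    exact measurableSet_Ioc
  · intro u hu x hx
    obtain ⟨ε, hε, hball⟩ := Metric.isOpen_iff.1 hu x hx
    refine ⟨Set.Ioc (x - ε / 2) (x + ε / 2), ⟨_, _, by linarith, rfl⟩,
      Ioc_mem_nhds (by linarith) (by linarith), fun y hy => hball ?_⟩
    rw [Metric.mem_ball, Real.dist_eq, abs_lt]
    constructor <;> linarith [hy.1, hy.2]
  · rintro _ ⟨a, b, hab, rfl⟩
    rw [← NNReal.tendsto_coe]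
    have hkey : ∀ κ : Measure ℝ, IsProbabilityMeasure κ →
        κ.real (Set.Ioc a b) = κ.real (Set.Iic b) - κ.real (Set.Iic a) := by
      intro κ _
      rw [← Set.Iic_sdiff_Iic, measureReal_sdiff (Set.Iic_subset_Iic.2 hab.le) measurableSet_Iic]
    have h1 := (h b).sub (h a)
    rw [cdf_eq_real, cdf_eq_real, ← hkey ν inferInstance] at h1
    have h2 : ∀ n, P.real {ω | V n ω ≤ b} - P.real {ω | V n ω ≤ a} =
        (P.map (V n)).real (Set.Ioc a b) := by
      intro n
      rw [hkey _ (Measure.isProbabilityMeasure_map (hV n).aemeasurable),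
        map_measureReal_apply (hV n) measurableSet_Iic,
        map_measureReal_apply (hV n) measurableSet_Iic]
      rfl
    simp_rw [h2] at h1
    convert h1 using 1
    · rfl
    · refine congrArg (𝓝 : ℝ → Filter ℝ) ?_
      change ((ν.map fun z => z) (Set.Ioc a b)).toReal = _
      rw [Measure.map_id']
      rfl

/-! ### Events of probability tending to one -/

/-- The events `E n` hold with probability tending to one; phrased through outer probabilities of
the complements, so that no measurability is needed. -/
def WithHighProb {Ω : Type*} [MeasurableSpace Ω] (P : Measure Ω) (E : ℕ → Ω → Prop) : Prop :=
  Tendsto (fun n => P.real {ω | ¬ E n ω}) atTop (𝓝 0)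

section WithHighProb

variable {Ω : Type*} [MeasurableSpace Ω] {P : Measure Ω} {E E' : ℕ → Ω → Prop}

lemma WithHighProb.of_le {r : ℕ → ℝ} (hr : Tendsto r atTop (𝓝 0))
    (h : ∀ᶠ n in atTop, P.real {ω | ¬ E n ω} ≤ r n) : WithHighProb P E :=
  squeeze_zero' (Eventually.of_forall fun _ => measureReal_nonneg) h hr

variable [IsProbabilityMeasure P]

lemma WithHighProb.mono (h : WithHighProb P E) (hE : ∀ᶠ n in atTop, ∀ ω, E n ω → E' n ω) :
    WithHighProb P E' :=
  WithHighProb.of_le h (hE.mono fun _ hn => measureReal_mono fun ω hω hE => hω (hn ω hE))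

lemma WithHighProb.and (h : WithHighProb P E) (h' : WithHighProb P E') :
    WithHighProb P fun n ω => E n ω ∧ E' n ω := by
  have hsum := Tendsto.add h h'
  rw [add_zero] at hsum
  refine WithHighProb.of_le hsum (Eventually.of_forall fun n => ?_)
  refine (measureReal_mono ?_).trans (measureReal_union_le _ _)
  intro ω hω
  by_cases hE : E n ω
  · exact Or.inr fun hE' => hω ⟨hE, hE'⟩
  · exact Or.inl hE

lemma WithHighProb.tendsto_one (h : WithHighProb P E)
    (hm : ∀ n, MeasurableSet {ω | E n ω}) : Tendsto (fun n => P {ω | E n ω}) atTop (𝓝 1) := by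
  have h1 : ∀ n, P.real {ω | E n ω} = 1 - P.real {ω | ¬ E n ω} := by
    intro n
    have : {ω | ¬ E n ω} = {ω | E n ω}ᶜ := rfl
    rw [this, probReal_compl_eq_one_sub (hm n)]
    ring
  have h2 : Tendsto (fun n => P.real {ω | E n ω}) atTop (𝓝 1) := by
    have := Tendsto.const_sub 1 h
    simp_rw [h1]
    simpa using this
  have h3 := ENNReal.tendsto_ofReal h2
  simpa [ofReal_measureReal] using h3

end WithHighProb

/-! ### The test statistic as a ratio of spacings -/

section Statistic

variable {Ω : Type*} {X : ℕ → Ω → ℝ} {k n : ℕ} {ω : Ω}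

/-- The weighted sum `∑ log (1 + 1 / (k + i)) (X_{n-k,n} - X_{n-k-i,n})` of spacings which enters
the test statistic. -/
def weightedSpacings {Ω : Type*} (X : ℕ → Ω → ℝ) (k n : ℕ) (ω : Ω) : ℝ :=
  ∑ i ∈ Finset.range k, Real.log (1 + 1 / ((k : ℝ) + (i : ℝ))) *
    (orderStat X (n - k) n ω - orderStat X (n - k - i) n ω)

lemma log_weight (hk : 1 ≤ k) (i : ℕ) : Real.log (1 + 1 / ((k : ℝ) + (i : ℝ))) =
    Real.log (((k : ℝ) + ((i + 1 : ℕ) : ℝ)) / k) - Real.log (((k : ℝ) + i) / k) := by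
  have hk0 : (0 : ℝ) < k := by exact_mod_cast hk
  have hki : (0 : ℝ) < (k : ℝ) + i := by positivity
  rw [← Real.log_div (by positivity) (by positivity)]
  congr 1
  push_cast
  field_simp
  ring

lemma log_weight_nonneg (k i : ℕ) : 0 ≤ Real.log (1 + 1 / ((k : ℝ) + (i : ℝ))) := by
  apply Real.log_nonneg
  have : 0 ≤ 1 / ((k : ℝ) + (i : ℝ)) := by positivity
  linarith

lemma log_weight_le (hk : 1 ≤ k) (i : ℕ) :
    Real.log (1 + 1 / ((k : ℝ) + (i : ℝ))) ≤ 1 / k := by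
  have hk0 : (0 : ℝ) < k := by exact_mod_cast hk
  have h1 := Real.log_le_sub_one_of_pos (show 0 < 1 + 1 / ((k : ℝ) + (i : ℝ)) by positivity)
  have h2 : 1 / ((k : ℝ) + (i : ℝ)) ≤ 1 / k := by
    apply one_div_le_one_div_of_le hk0
    have : (0 : ℝ) ≤ i := i.cast_nonneg
    linarith
  linarith

lemma sum_log_weight (hk : 1 ≤ k) :
    ∑ i ∈ Finset.range k, Real.log (1 + 1 / ((k : ℝ) + (i : ℝ))) = Real.log 2 := by
  have hk0 : (0 : ℝ) < k := by exact_mod_cast hk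
  simp_rw [log_weight hk]
  rw [Finset.sum_range_sub fun i : ℕ => Real.log (((k : ℝ) + (i : ℝ)) / k)]
  have h1 : ((k : ℝ) + k) / k = 2 := by field_simp; ring
  simp [h1, hk0.ne']

lemma log_two_mul_testStat (hk : 1 ≤ k) : Real.log 2 * testStat X k n ω =
    (Real.log 2 * (orderStat X n n ω - orderStat X (n - k) n ω) + weightedSpacings X k n ω) /
      (orderStat X (n - k) n ω - orderStat X (n - 2 * k) n ω) := by
  have hl : Real.log 2 ≠ 0 := (Real.log_pos one_lt_two).ne'
  rw [testStat, ← mul_div_assoc]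
  congr 1
  rw [endpointEstimator, weightedSpacings]
  simp_rw [mul_sub, Finset.sum_sub_distrib, ← Finset.sum_mul]
  rw [sum_log_weight hk]
  field_simp
  ring

lemma spacing_mem (hkn : 2 * k < n) {i : ℕ} (hi : i < k) :
    0 ≤ orderStat X (n - k) n ω - orderStat X (n - k - i) n ω ∧
    orderStat X (n - k) n ω - orderStat X (n - k - i) n ω ≤
      orderStat X (n - k) n ω - orderStat X (n - 2 * k) n ω := by
  have h1 : orderStat X (n - k - i) n ω ≤ orderStat X (n - k) n ω :=
    orderStat_mono (by omega) (by omega) (by omega)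
  have h2 : orderStat X (n - 2 * k) n ω ≤ orderStat X (n - k - i) n ω :=
    orderStat_mono (by omega) (by omega) (by omega)
  constructor <;> linarith

lemma weightedSpacings_nonneg (hkn : 2 * k < n) : 0 ≤ weightedSpacings X k n ω :=
  Finset.sum_nonneg fun i hi =>
    mul_nonneg (log_weight_nonneg k i) (spacing_mem hkn (Finset.mem_range.1 hi)).1

lemma weightedSpacings_le (hk : 1 ≤ k) (hkn : 2 * k < n) : weightedSpacings X k n ω ≤
    Real.log 2 * (orderStat X (n - k) n ω - orderStat X (n - 2 * k) n ω) := by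
  rw [← sum_log_weight hk, Finset.sum_mul]
  exact Finset.sum_le_sum fun i hi =>
    mul_le_mul_of_nonneg_left (spacing_mem hkn (Finset.mem_range.1 hi)).2 (log_weight_nonneg k i)

end Statistic

/-! ### High-probability bounds for order statistics -/

section Asymptotics

variable {Ω : Type*} [MeasurableSpace Ω] {P : Measure Ω} [IsProbabilityMeasure P]
  {μ : Measure ℝ} [IsProbabilityMeasure μ] {X : ℕ → Ω → ℝ} {k : ℕ → ℕ}

lemma tendsto_ratio (hk : Tendsto k atTop atTop)
    (hkn : Tendsto (fun n : ℕ => (k n : ℝ) / (n : ℝ)) atTop (𝓝 0)) :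
    Tendsto (fun n : ℕ => (n : ℝ) / (k n : ℝ)) atTop atTop := by
  have h1 : Tendsto (fun n : ℕ => (k n : ℝ) / (n : ℝ)) atTop (𝓝[>] 0) := by
    refine tendsto_nhdsWithin_iff.2 ⟨hkn, ?_⟩
    filter_upwards [hk.eventually_ge_atTop 1, eventually_ge_atTop 1] with n h1 h2
    have h1' : (0 : ℝ) < k n := by exact_mod_cast h1
    have h2' : (0 : ℝ) < n := by exact_mod_cast h2
    exact div_pos h1' h2'
  refine (tendsto_inv_nhdsGT_zero.comp h1).congr fun n => ?_
  simp

lemma eventually_mul_lt (hkn : Tendsto (fun n : ℕ => (k n : ℝ) / (n : ℝ)) atTop (𝓝 0)) (c : ℕ)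
    (hc : 0 < c) : ∀ᶠ n in atTop, c * k n < n := by
  have hc' : (0 : ℝ) < c := by exact_mod_cast hc
  filter_upwards [hkn.eventually (gt_mem_nhds (show (0 : ℝ) < 1 / c by positivity)),
    eventually_ge_atTop 1] with n h1 h2
  have h2' : (0 : ℝ) < n := by exact_mod_cast h2
  rw [div_lt_div_iff₀ h2' hc'] at h1
  have : (c : ℝ) * k n < n := by linarith
  exact_mod_cast this

lemma withHighProb_orderStat (hX : ∀ i, Measurable (X i)) (hindep : iIndepFun X P)
    (hlaw : ∀ i, P.map (X i) = μ) {m : ℕ → ℕ} {δ : ℕ → ℝ} (hm : ∀ᶠ n in atTop, 1 ≤ m n)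
    (hδ : ∀ᶠ n in atTop, 0 < δ n ∧ δ n < 1) (hmn : ∀ᶠ n in atTop, 2 * m n < n)
    (hrate : Tendsto (fun n => δ n ^ 2 * m n) atTop atTop) :
    WithHighProb P fun n ω =>
      tailQuantile (cdf μ) (n / (m n * (1 + δ n))) ≤ orderStat X (n - m n) n ω ∧
      orderStat X (n - m n) n ω ≤ tailQuantile (cdf μ) (n / (m n * (1 - δ n))) := by
  refine WithHighProb.of_le (hrate.const_div_atTop 3) ?_
  filter_upwards [hm, hδ, hmn] with n hm hδ hmn
  have h2 : (2 : ℝ) * m n < n := by exact_mod_cast hmn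
  refine measureReal_not_orderStat_mem hX hindep hlaw hm hδ.1 hδ.2 ?_
  have : (0 : ℝ) ≤ m n := Nat.cast_nonneg _
  nlinarith [hδ.2]

/-- The spacing in the denominator of the test statistic has the exact order of the scale
function. -/
lemma withHighProb_spacings (hX : ∀ i, Measurable (X i)) (hindep : iIndepFun X P)
    (hlaw : ∀ i, P.map (X i) = μ) {γ ρ : ℝ} {a A₀ : ℝ → ℝ}
    (hU : SecondOrderCondition (tailQuantile (cdf μ)) γ ρ a A₀) (hk : Tendsto k atTop atTop)
    (hkn : Tendsto (fun n : ℕ => (k n : ℝ) / (n : ℝ)) atTop (𝓝 0)) :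
    ∃ d₁ d₂ d₃ : ℝ, 0 < d₁ ∧ 0 < d₂ ∧ WithHighProb P fun n ω =>
      d₁ * scaleZero γ ρ a A₀ (n / k n) ≤
        orderStat X (n - k n) n ω - orderStat X (n - 2 * k n) n ω ∧
      orderStat X (n - k n) n ω - orderStat X (n - 2 * k n) n ω ≤
        d₂ * scaleZero γ ρ a A₀ (n / k n) ∧
      |orderStat X (n - k n) n ω - tailQuantile (cdf μ) (n / k n)| ≤
        d₃ * scaleZero γ ρ a A₀ (n / k n) := by
  have ht := tendsto_ratio hk hkn
  have hkR : Tendsto (fun n => (k n : ℝ)) atTop atTop := tendsto_natCast_atTop_atTop.comp hk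
  have hk1 := hk.eventually_ge_atTop 1
  have hδ : ∀ᶠ n : ℕ in atTop, (0 : ℝ) < 1 / 4 ∧ (1 / 4 : ℝ) < 1 :=
    Eventually.of_forall fun _ => by norm_num
  have hw1 := withHighProb_orderStat (P := P) hX hindep hlaw (m := k) (δ := fun _ => 1 / 4) hk1 hδ
    (eventually_mul_lt hkn 2 (by norm_num)) (hkR.const_mul_atTop (by norm_num))
  have hw2 := withHighProb_orderStat (P := P) hX hindep hlaw (m := fun n => 2 * k n)
    (δ := fun _ => 1 / 4) (hk1.mono fun n hn => by omega) hδ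
    ((eventually_mul_lt hkn 4 (by norm_num)).mono fun n hn => by omega)
    (by
      push_cast
      exact (hkR.const_mul_atTop (by norm_num)).const_mul_atTop (by norm_num))
  have hgap : powerQuot γ (2 / 3) < powerQuot γ (4 / 5) :=
    powerQuot_lt_powerQuot (by norm_num) (by norm_num)
  have hgap' : powerQuot γ (2 / 5) < powerQuot γ (4 / 3) :=
    powerQuot_lt_powerQuot (by norm_num) (by norm_num)
  set q := fun x => powerQuot γ x
  -- for `δ = 1 / 4` the quantile levels of `X_{n-k,n}` and `X_{n-2k,n}` are `4 / 5`, `4 / 3` and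
  -- `2 / 5`, `2 / 3` times `n / k`, so that the two ranges do not overlap
  set η := (q (4 / 5) - q (2 / 3)) / 4 with hη
  have hη0 : 0 < η := by
    change 0 < (powerQuot γ (4 / 5) - powerQuot γ (2 / 3)) / 4
    linarith
  have hfo : ∀ x : ℝ, 0 < x → ∀ᶠ n : ℕ in atTop,
      |(tailQuantile (cdf μ) (n / k n * x) - tailQuantile (cdf μ) (n / k n)) /
        scaleZero γ ρ a A₀ (n / k n) - q x| < η := by
    intro x hx
    have h1 := (hU.first_order hx).comp ht
    have h2 := (h1.sub_const (q x)).abs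
    rw [sub_self, abs_zero] at h2
    exact h2.eventually (gt_mem_nhds hη0)
  refine ⟨2 * η, q (4 / 3) - q (2 / 5) + 2 * η, |q (4 / 5)| + |q (4 / 3)| + η, by positivity, ?_,
    (hw1.and hw2).mono ?_⟩
  · have : q (2 / 5) < q (4 / 3) := hgap'
    linarith
  filter_upwards [ht.eventually hU.scaleZero_pos, hk1, hfo (4 / 5) (by norm_num),
    hfo (4 / 3) (by norm_num), hfo (2 / 5) (by norm_num), hfo (2 / 3) (by norm_num)]
    with n hb hk1 h1 h2 h3 h4 ω hω
  have hk0 : (0 : ℝ) < k n := by exact_mod_cast hk1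
  obtain ⟨⟨g1, g2⟩, ⟨g3, g4⟩⟩ := hω
  push_cast at g3 g4
  have e1 : (n : ℝ) / (k n * (1 + 1 / 4)) = n / k n * (4 / 5) := by field_simp; norm_num
  have e2 : (n : ℝ) / (k n * (1 - 1 / 4)) = n / k n * (4 / 3) := by field_simp; norm_num
  have e3 : (n : ℝ) / (2 * k n * (1 + 1 / 4)) = n / k n * (2 / 5) := by field_simp; norm_num
  have e4 : (n : ℝ) / (2 * k n * (1 - 1 / 4)) = n / k n * (2 / 3) := by field_simp; norm_num
  rw [e1] at g1
  rw [e2] at g2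
  rw [e3] at g3
  rw [e4] at g4
  set b := scaleZero γ ρ a A₀ (n / k n)
  set u := tailQuantile (cdf μ) (n / k n)
  rw [abs_lt, neg_lt_sub_iff_lt_add, sub_lt_iff_lt_add, div_lt_iff₀ hb] at h1 h2 h3 h4
  replace h1 := h1.1
  replace h2 := h2.2
  replace h3 := h3.1
  replace h4 := h4.2
  rw [← sub_lt_iff_lt_add', lt_div_iff₀ hb] at h1 h3
  have h5 : -(|q (4 / 5)| * b) ≤ q (4 / 5) * b := by
    rw [← neg_mul]
    exact mul_le_mul_of_nonneg_right (neg_abs_le _) hb.le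
  have h6 : q (4 / 3) * b ≤ |q (4 / 3)| * b := mul_le_mul_of_nonneg_right (le_abs_self _) hb.le
  have h7 : 0 ≤ |q (4 / 5)| * b := by positivity
  have h8 : 0 ≤ |q (4 / 3)| * b := by positivity
  have h9 : 4 * η * b = q (4 / 5) * b - q (2 / 3) * b := by rw [hη]; ring
  refine ⟨?_, ?_, ?_⟩
  · linarith
  · linarith
  · rw [abs_le]
    constructor <;> linarith

/-- The factor `√k` may be replaced by any diverging `o (k)`; it only has to outgrow a power
of `log k`. -/
lemma withHighProb_le_max (hX : ∀ i, Measurable (X i)) (hindep : iIndepFun X P)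
    (hlaw : ∀ i, P.map (X i) = μ) (hk : Tendsto k atTop atTop)
    (hkn : Tendsto (fun n : ℕ => (k n : ℝ) / (n : ℝ)) atTop (𝓝 0)) :
    WithHighProb P fun n ω =>
      tailQuantile (cdf μ) (n / k n * Real.sqrt (k n)) ≤ orderStat X n n ω := by
  have hkR : Tendsto (fun n => (k n : ℝ)) atTop atTop := tendsto_natCast_atTop_atTop.comp hk
  have hlim : Tendsto (fun n => Real.exp (-Real.sqrt (k n))) atTop (𝓝 0) :=
    Real.tendsto_exp_neg_atTop_nhds_zero.comp (Real.tendsto_sqrt_atTop.comp hkR)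
  refine WithHighProb.of_le hlim ?_
  filter_upwards [hk.eventually_ge_atTop 1, eventually_mul_lt hkn 1 one_pos] with n hk1 hn
  have hk0 : (1 : ℝ) ≤ k n := by exact_mod_cast hk1
  have hn' : (k n : ℝ) < n := by
    rw [one_mul] at hn
    exact_mod_cast hn
  have hn0 : (0 : ℝ) < n := by linarith
  have hs : 1 ≤ Real.sqrt (k n) := Real.one_le_sqrt.2 hk0
  have hss : Real.sqrt (k n) * Real.sqrt (k n) = k n := Real.mul_self_sqrt (by linarith)
  set s := Real.sqrt (k n)
  have ht : 1 < n / k n * s := by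
    rw [div_mul_eq_mul_div, lt_div_iff₀ (by linarith)]
    nlinarith
  set u := tailQuantile (cdf μ) (n / k n * s)
  have hsub : {ω | ¬ u ≤ orderStat X n n ω} ⊆ {ω | ∀ i < n, X i ω ∈ Set.Iio u} := by
    intro ω hω i hi
    exact (le_orderStat_top hi).trans_lt (not_le.1 hω)
  refine (measureReal_mono hsub).trans ?_
  rw [measureReal_forall_mem hX hindep hlaw n measurableSet_Iio]
  have h1 := measureReal_Iio_tailQuantile_le (μ := μ) ht
  have h2 : 1 / (n / k n * s) = s / n := by
    rw [← hss]
    field_simp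
  rw [h2] at h1
  have h3 : 1 - s / n ≤ Real.exp (-(s / n)) := by
    have := Real.add_one_le_exp (-(s / n))
    linarith
  calc μ.real (Set.Iio u) ^ n ≤ Real.exp (-(s / n)) ^ n := by
        gcongr
        exact h1.trans h3
    _ = Real.exp (-s) := by
        rw [← Real.exp_nat_mul]
        congr 1
        field_simp

/-- A bound far beyond the typical size `U n` of the maximum, sufficient for a negative index. -/
lemma withHighProb_max_le (hX : ∀ i, Measurable (X i)) (hindep : iIndepFun X P)
    (hlaw : ∀ i, P.map (X i) = μ) (hk : Tendsto k atTop atTop) :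
    WithHighProb P fun n ω =>
      orderStat X n n ω ≤ tailQuantile (cdf μ) (n / k n * (k n * k n)) := by
  have hkR : Tendsto (fun n => (k n : ℝ)) atTop atTop := tendsto_natCast_atTop_atTop.comp hk
  refine WithHighProb.of_le (hkR.const_div_atTop 1) ?_
  filter_upwards [hk.eventually_ge_atTop 2, eventually_ge_atTop 1] with n hk2 hn
  have hk0 : (2 : ℝ) ≤ k n := by exact_mod_cast hk2
  have hn1 : (1 : ℝ) ≤ n := by exact_mod_cast hn
  have e : (n : ℝ) / k n * (k n * k n) = n * k n := by field_simp
  rw [e]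
  have ht : 1 < (n : ℝ) * k n := by nlinarith
  set u := tailQuantile (cdf μ) (n * k n)
  have hset : {ω | ¬ orderStat X n n ω ≤ u} = {ω | ∀ i < n, X i ω ∈ Set.Iic u}ᶜ := by
    ext ω
    exact (orderStat_top_le_iff hn u).not
  have hmeas : MeasurableSet {ω | ∀ i < n, X i ω ∈ Set.Iic u} := by
    have : {ω | ∀ i < n, X i ω ∈ Set.Iic u} = {ω | orderStat X n n ω ≤ u} := by
      ext ω
      exact (orderStat_top_le_iff hn u).symm
    rw [this]
    exact measurableSet_le (measurable_orderStat hX n n) measurable_const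
  rw [hset, probReal_compl_eq_one_sub hmeas,
    measureReal_forall_mem hX hindep hlaw n measurableSet_Iic, ← cdf_eq_real]
  have h1 := le_cdf_tailQuantile (μ := μ) ht
  have h2 : 1 / ((n : ℝ) * k n) ≤ 1 := by rw [div_le_one (by linarith)]; linarith
  have h3 := one_add_mul_le_pow (a := -(1 / ((n : ℝ) * k n))) (by linarith) n
  have h4 : (1 + -(1 / ((n : ℝ) * k n))) ^ n ≤ cdf μ u ^ n := by
    gcongr
    · linarith
    · linarith
  have h5 : (n : ℝ) * -(1 / ((n : ℝ) * k n)) = -(1 / k n) := by field_simp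
  rw [h5] at h3
  linarith

/-! ### Nonzero index -/

lemma withHighProb_lt_testStatStar (hX : ∀ i, Measurable (X i)) (hindep : iIndepFun X P)
    (hlaw : ∀ i, P.map (X i) = μ) {γ ρ : ℝ} {a A₀ : ℝ → ℝ}
    (hU : SecondOrderCondition (tailQuantile (cdf μ)) γ ρ a A₀) (hk : Tendsto k atTop atTop)
    (hkn : Tendsto (fun n : ℕ => (k n : ℝ) / (n : ℝ)) atTop (𝓝 0)) (hγ : 0 < γ) (M : ℝ) :
    WithHighProb P fun n ω => M < testStatStar X (k n) n ω := by
  have ht := tendsto_ratio hk hkn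
  have hkR : Tendsto (fun n => (k n : ℝ)) atTop atTop := tendsto_natCast_atTop_atTop.comp hk
  obtain ⟨d₁, d₂, d₃, hd₁, hd₂, hsp⟩ := withHighProb_spacings hX hindep hlaw hU hk hkn
  obtain ⟨c, T, hc, hgrow⟩ := hU.increment_lower monotoneOn_tailQuantile hγ
  have hl2 : 0 < Real.log 2 := Real.log_pos one_lt_two
  -- a power of `k` dominates `log k`
  have hlim : ∀ᶠ n in atTop, M + (Real.log (k n) + Real.log 2 / 2) <
      Real.log 2 * (c * Real.sqrt (k n) ^ (γ / 2) - d₃) / d₂ := by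
    have hsq : ∀ᶠ x : ℝ in atTop, Real.log x ≤ (Real.log 2 * c / (2 * d₂)) * x ^ (γ / 4) := by
      have h1 := (isLittleO_log_rpow_atTop (show 0 < γ / 4 by positivity)).bound
        (show 0 < Real.log 2 * c / (2 * d₂) by positivity)
      filter_upwards [h1, eventually_ge_atTop (1 : ℝ)] with x hx hx1
      rw [Real.norm_of_nonneg (Real.log_nonneg hx1), Real.norm_of_nonneg (by positivity)] at hx
      exact hx
    have hbig : ∀ᶠ x : ℝ in atTop, M + Real.log 2 / 2 + Real.log 2 * d₃ / d₂ <
        (Real.log 2 * c / (2 * d₂)) * x ^ (γ / 4) :=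
      ((tendsto_rpow_atTop (show 0 < γ / 4 by positivity)).const_mul_atTop
        (by positivity)).eventually_gt_atTop _
    filter_upwards [hkR.eventually hsq, hkR.eventually hbig] with n h1 h2
    have e : Real.sqrt (k n) ^ (γ / 2) = (k n : ℝ) ^ (γ / 4) := by
      rw [Real.sqrt_eq_rpow, ← Real.rpow_mul (Nat.cast_nonneg _)]
      congr 1
      ring
    rw [e]
    have e2 : Real.log 2 * (c * (k n : ℝ) ^ (γ / 4) - d₃) / d₂ =
        (Real.log 2 * c / (2 * d₂)) * (k n : ℝ) ^ (γ / 4) +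
        (Real.log 2 * c / (2 * d₂)) * (k n : ℝ) ^ (γ / 4) - Real.log 2 * d₃ / d₂ := by
      field_simp
      ring
    linarith
  have hlim' : ∀ᶠ n in atTop, d₃ ≤ c * Real.sqrt (k n) ^ (γ / 2) := by
    have h1 := (tendsto_rpow_atTop (show 0 < γ / 2 by positivity)).comp
      (Real.tendsto_sqrt_atTop.comp hkR)
    exact (h1.const_mul_atTop hc).eventually_ge_atTop _
  refine (hsp.and (withHighProb_le_max (P := P) hX hindep hlaw hk hkn)).mono ?_
  filter_upwards [hlim, hlim', hk.eventually_ge_atTop 1, eventually_mul_lt hkn 2 two_pos,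
    ht.eventually hU.scaleZero_pos, ht.eventually_ge_atTop T,
    (Real.tendsto_sqrt_atTop.comp hkR).eventually_ge_atTop (Real.exp 1)]
    with n hM hM' hk1 hn hb hT hsq ω hω
  obtain ⟨⟨h1, h2, h3⟩, h4⟩ := hω
  have h5 := hgrow _ hT _ hsq
  simp only [Function.comp] at h5
  have h6 := weightedSpacings_nonneg (X := X) (ω := ω) hn
  rw [testStatStar, log_two_mul_testStat hk1, lt_sub_iff_add_lt]
  refine hM.trans_le ?_
  set b := scaleZero γ ρ a A₀ (n / k n)
  set D := orderStat X (n - k n) n ω - orderStat X (n - 2 * k n) n ω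
  have hD : 0 < D := lt_of_lt_of_le (by positivity) h1
  set y := c * Real.sqrt (k n) ^ (γ / 2)
  have h7 : (y - d₃) * b ≤ orderStat X n n ω - orderStat X (n - k n) n ω := by
    have := (abs_le.1 h3).2
    linarith
  rw [div_le_div_iff₀ hd₂ hD]
  have h8 : 0 ≤ y - d₃ := by linarith
  calc Real.log 2 * (y - d₃) * D ≤ Real.log 2 * (y - d₃) * (d₂ * b) := by gcongr
    _ = Real.log 2 * ((y - d₃) * b) * d₂ := by ring
    _ ≤ (Real.log 2 * (orderStat X n n ω - orderStat X (n - k n) n ω) +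
        weightedSpacings X (k n) n ω) * d₂ := by
      gcongr
      have := mul_le_mul_of_nonneg_left h7 hl2.le
      linarith

lemma withHighProb_testStatStar_lt (hX : ∀ i, Measurable (X i)) (hindep : iIndepFun X P)
    (hlaw : ∀ i, P.map (X i) = μ) {γ ρ : ℝ} {a A₀ : ℝ → ℝ}
    (hU : SecondOrderCondition (tailQuantile (cdf μ)) γ ρ a A₀) (hk : Tendsto k atTop atTop)
    (hkn : Tendsto (fun n : ℕ => (k n : ℝ) / (n : ℝ)) atTop (𝓝 0)) (hγ : γ < 0) (M : ℝ) :
    WithHighProb P fun n ω => testStatStar X (k n) n ω < M := by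
  have ht := tendsto_ratio hk hkn
  have hkR : Tendsto (fun n => (k n : ℝ)) atTop atTop := tendsto_natCast_atTop_atTop.comp hk
  obtain ⟨d₁, d₂, d₃, hd₁, hd₂, hsp⟩ := withHighProb_spacings hX hindep hlaw hU hk hkn
  obtain ⟨C, T, hC, hgrow⟩ := hU.increment_upper monotoneOn_tailQuantile hγ
  have hl2 : 0 < Real.log 2 := Real.log_pos one_lt_two
  have hlim : ∀ᶠ n in atTop, Real.log 2 * ((C + |d₃|) / d₁) + Real.log 2 - M <
      Real.log (k n) := (Real.tendsto_log_atTop.comp hkR).eventually_gt_atTop _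
  refine (hsp.and (withHighProb_max_le (P := P) hX hindep hlaw hk)).mono ?_
  filter_upwards [hlim, hk.eventually_ge_atTop 1, eventually_mul_lt hkn 2 two_pos,
    ht.eventually hU.scaleZero_pos, ht.eventually_ge_atTop T] with n hM hk1 hn hb hT ω hω
  obtain ⟨⟨h1, h2, h3⟩, h4⟩ := hω
  have hk0 : (1 : ℝ) ≤ k n := by exact_mod_cast hk1
  have h5 := hgrow _ hT (k n * k n) (by nlinarith)
  have h6 := weightedSpacings_le (X := X) (ω := ω) hk1 hn
  rw [testStatStar, log_two_mul_testStat hk1]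
  set b := scaleZero γ ρ a A₀ (n / k n)
  set D := orderStat X (n - k n) n ω - orderStat X (n - 2 * k n) n ω
  have hD : 0 < D := lt_of_lt_of_le (by positivity) h1
  have h7 : orderStat X n n ω - orderStat X (n - k n) n ω ≤ (C + |d₃|) / d₁ * D := by
    have h8 := (abs_le.1 h3).1
    have h9 : d₃ * b ≤ |d₃| * b := mul_le_mul_of_nonneg_right (le_abs_self _) hb.le
    calc orderStat X n n ω - orderStat X (n - k n) n ω ≤ (C + |d₃|) / d₁ * (d₁ * b) := by
          field_simp
          linarith
      _ ≤ _ := by gcongr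
  have h10 : (Real.log 2 * (orderStat X n n ω - orderStat X (n - k n) n ω) +
      weightedSpacings X (k n) n ω) / D ≤ Real.log 2 * ((C + |d₃|) / d₁) + Real.log 2 := by
    rw [div_le_iff₀ hD]
    have := mul_le_mul_of_nonneg_left h7 hl2.le
    linarith
  linarith

end Asymptotics

/-! ### The Gumbel law -/

lemma continuous_gev_zero : Continuous (gev 0) := by
  unfold gev
  simp only [if_true]
  fun_prop

lemma gev_zero (x : ℝ) : gev 0 x = Real.exp (-Real.exp (-x)) := by simp [gev]

/-- The Gumbel distribution function is the distribution function of a probability measure. -/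
lemma exists_gumbel : ∃ (ν : Measure ℝ) (_ : IsProbabilityMeasure ν),
    ∀ z : ℝ, cdf ν z = gev 0 z := by
  let f : StieltjesFunction ℝ :=
    { toFun := gev 0
      mono' := fun x y hxy => by
        rw [gev_zero, gev_zero]
        gcongr
      right_continuous' := fun x => continuous_gev_zero.continuousWithinAt }
  have h0 : Tendsto f atBot (𝓝 0) := by
    have h1 : Tendsto (fun x : ℝ => Real.exp (-x)) atBot atTop :=
      Real.tendsto_exp_atTop.comp tendsto_neg_atBot_atTop
    exact (Real.tendsto_exp_neg_atTop_nhds_zero.comp h1).congr fun x => (gev_zero x).symm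
  have h1 : Tendsto f atTop (𝓝 1) := by
    have h2 := (Real.continuous_exp.tendsto (-0)).comp Real.tendsto_exp_neg_atTop_nhds_zero.neg
    rw [neg_zero, Real.exp_zero] at h2
    exact h2.congr fun x => (gev_zero x).symm
  refine ⟨f.measure, f.isProbabilityMeasure h0 h1, fun z => ?_⟩
  rw [cdf_measure_stieltjesFunction f h0 h1]

lemma tendsto_one_sub_exp_div_pow (z : ℝ) :
    Tendsto (fun n : ℕ => (1 - Real.exp (-z) / n) ^ n) atTop (𝓝 (gev 0 z)) := by
  rw [gev_zero]
  refine (Real.tendsto_one_add_div_pow_exp (-Real.exp (-z))).congr fun n => ?_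
  rw [neg_div, ← sub_eq_add_neg]

/-! ### Deterministic estimates of spacings -/

/-- Deterministic estimate of an intermediate order statistic which lies between two neighbouring
tail quantiles. -/
lemma abs_sub_log_le {U b A₀ : ℝ → ℝ} {C t k m δ x : ℝ} (hk : 0 < k) (hm : k ≤ m)
    (hm2 : m ≤ 2 * k) (hδ0 : 0 ≤ δ) (hδ : δ ≤ 1 / 2) (hb : 0 < b t)
    (hlog : ∀ x ∈ Set.Icc (1 / 4 : ℝ) 4, |U (t * x) - U t - b t * Real.log x| ≤
      C * (b t * |A₀ t|))
    (h1 : U (t * (k / (m * (1 + δ)))) ≤ x) (h2 : x ≤ U (t * (k / (m * (1 - δ))))) :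
    |x - U t - b t * Real.log (k / m)| ≤ b t * (C * |A₀ t| + 2 * δ) := by
  have hm0 : 0 < m := hk.trans_le hm
  have hd1 : 0 < 1 + δ := by linarith
  have hd2 : 0 < 1 - δ := by linarith
  have e1 : Real.log (k / (m * (1 + δ))) = Real.log (k / m) - Real.log (1 + δ) := by
    rw [← div_div, Real.log_div (by positivity) hd1.ne']
  have e2 : Real.log (k / (m * (1 - δ))) = Real.log (k / m) - Real.log (1 - δ) := by
    rw [← div_div, Real.log_div (by positivity) hd2.ne']
  have h3 := hlog (k / (m * (1 + δ))) ⟨by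
    rw [div_le_div_iff₀ (by norm_num) (by positivity)]; nlinarith, by
    rw [div_le_iff₀ (by positivity)]; nlinarith⟩
  have h4 := hlog (k / (m * (1 - δ))) ⟨by
    rw [div_le_div_iff₀ (by norm_num) (by positivity)]; nlinarith, by
    rw [div_le_iff₀ (by positivity)]; nlinarith⟩
  rw [e1] at h3
  rw [e2] at h4
  have h5 : Real.log (1 + δ) ≤ 2 * δ := by
    have := Real.log_le_sub_one_of_pos hd1
    linarith
  have h6 : -Real.log (1 - δ) ≤ 2 * δ := by
    have h7 := Real.log_le_sub_one_of_pos (inv_pos.2 hd2)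
    rw [Real.log_inv] at h7
    refine h7.trans ?_
    rw [sub_le_iff_le_add, inv_le_iff_one_le_mul₀ hd2]
    nlinarith
  have h8 := mul_le_mul_of_nonneg_left h5 hb.le
  have h9 := mul_le_mul_of_nonneg_left h6 hb.le
  rw [abs_le] at *
  constructor <;> nlinarith

/-- Abel summation: the weights are the increments of `i ↦ log (1 + i / k)`, so the weighted sum of
these logarithms telescopes to half a square, up to the sum of the squared weights. -/
lemma abs_sum_log_weight_mul_log (k : ℕ) (hk : 1 ≤ k) :
    |∑ i ∈ Finset.range k, Real.log (1 + 1 / ((k : ℝ) + (i : ℝ))) *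
      Real.log (((k : ℝ) + i) / k) - Real.log 2 ^ 2 / 2| ≤ 1 / (k : ℝ) := by
  have hk0 : (0 : ℝ) < k := by exact_mod_cast hk
  set L : ℕ → ℝ := fun i => Real.log (((k : ℝ) + i) / k) with hL
  set c : ℕ → ℝ := fun i => Real.log (1 + 1 / ((k : ℝ) + (i : ℝ))) with hc
  have hcL : ∀ i, c i = L (i + 1) - L i := fun i => log_weight hk i
  have hLk : L k = Real.log 2 := by
    simp only [hL]
    congr 1
    field_simp
    ring
  have hL0 : L 0 = 0 := by simp [hL, hk0.ne']
  have h1 : ∀ i, c i * L i = (L (i + 1) ^ 2 - L i ^ 2) / 2 - c i ^ 2 / 2 := fun i => by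
    rw [hcL]
    ring
  have h2 : ∑ i ∈ Finset.range k, c i * L i =
      Real.log 2 ^ 2 / 2 - (∑ i ∈ Finset.range k, c i ^ 2) / 2 := by
    simp_rw [h1]
    rw [Finset.sum_sub_distrib, ← Finset.sum_div, ← Finset.sum_div,
      Finset.sum_range_sub fun i => L i ^ 2, hLk, hL0]
    ring
  have h3 : ∑ i ∈ Finset.range k, c i ^ 2 ≤ 1 / k := by
    calc ∑ i ∈ Finset.range k, c i ^ 2 ≤ ∑ i ∈ Finset.range k, (1 / (k : ℝ)) ^ 2 := by
          refine Finset.sum_le_sum fun i _ => ?_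
          exact pow_le_pow_left₀ (log_weight_nonneg k i) (log_weight_le hk i) 2
      _ = 1 / k := by
        rw [Finset.sum_const, Finset.card_range, nsmul_eq_mul]
        field_simp
  have h4 : 0 ≤ ∑ i ∈ Finset.range k, c i ^ 2 := Finset.sum_nonneg fun i _ => sq_nonneg _
  change |∑ i ∈ Finset.range k, c i * L i - Real.log 2 ^ 2 / 2| ≤ 1 / (k : ℝ)
  rw [h2, abs_le]
  have h5 : 0 ≤ 1 / (k : ℝ) := by positivity
  constructor <;> linarith

/-- `m` is an exceptional index if `X_{n-m,n}` is not between the tail quantiles at the levels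
`n / (m (1 ± δ))`. -/
def exceptionalSet {Ω : Type*} (X : ℕ → Ω → ℝ) (U : ℝ → ℝ) (δ : ℝ) (n m : ℕ) : Set Ω :=
  {ω | ¬ (U (n / (m * (1 + δ))) ≤ orderStat X (n - m) n ω ∧
    orderStat X (n - m) n ω ≤ U (n / (m * (1 - δ))))}

/-- The weighted sum of spacings, up to the accuracy `r` for the non-exceptional indices and the
proportion `δ` of exceptional ones. -/
lemma abs_weightedSpacings_sub_le {U b A₀ : ℝ → ℝ} {C δ r : ℝ} {k n : ℕ} {ω : Ω} (hk : 1 ≤ k)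
    (hkn : 2 * k < n) (hδ0 : 0 ≤ δ) (hδ : δ ≤ 1 / 2) (hb : 0 < b (n / k))
    (hr : C * |A₀ (n / k)| + 2 * δ ≤ r)
    (hlog : ∀ x ∈ Set.Icc (1 / 4 : ℝ) 4,
      |U (n / k * x) - U (n / k) - b (n / k) * Real.log x| ≤ C * (b (n / k) * |A₀ (n / k)|))
    (h1 : |orderStat X (n - k) n ω - U (n / k)| ≤ b (n / k) * r)
    (h2 : |orderStat X (n - 2 * k) n ω - U (n / k) + b (n / k) * Real.log 2| ≤ b (n / k) * r)
    (hfew : ∑ i ∈ Finset.range k,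
      (exceptionalSet X U δ n (k + i)).indicator (fun _ => (1 : ℝ)) ω ≤ δ * k) :
    |weightedSpacings X k n ω - b (n / k) * (Real.log 2 ^ 2 / 2)| ≤
      b (n / k) * (2 * r + 2 * δ + 1 / k) := by
  have hk0 : (0 : ℝ) < k := by exact_mod_cast hk
  set β := b (n / k)
  set A := orderStat X (n - k) n ω
  have hl2 : Real.log 2 < 1 := Real.log_two_lt_d9.trans (by norm_num)
  have hr0 : 0 ≤ r := by
    have := (abs_nonneg _).trans h1
    exact nonneg_of_mul_nonneg_right this hb
  have hterm : ∀ i ∈ Finset.range k,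
      |A - orderStat X (n - k - i) n ω - β * Real.log (((k : ℝ) + i) / k)| ≤
      β * (2 * r + 2 * (exceptionalSet X U δ n (k + i)).indicator (fun _ => (1 : ℝ)) ω) := by
    intro i hi
    have hi' : i < k := Finset.mem_range.1 hi
    have hiR : (i : ℝ) ≤ k := by exact_mod_cast hi'.le
    have hi0 : (0 : ℝ) ≤ i := i.cast_nonneg
    by_cases hex : ω ∈ exceptionalSet X U δ n (k + i)
    -- an exceptional order statistic is still between `X_{n-2k,n}` and `X_{n-k,n}`
    · rw [Set.indicator_of_mem hex]
      obtain ⟨h3, h4⟩ := spacing_mem (X := X) (ω := ω) hkn hi'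
      have h5 : 0 ≤ Real.log (((k : ℝ) + i) / k) := by
        apply Real.log_nonneg
        rw [one_le_div hk0]
        linarith
      have h6 : Real.log (((k : ℝ) + i) / k) ≤ Real.log 2 := by
        apply Real.log_le_log (by positivity)
        rw [div_le_iff₀ hk0]
        linarith
      have h7 := mul_le_mul_of_nonneg_left h6 hb.le
      have h8 := mul_nonneg hb.le h5
      have h9 : β * Real.log 2 ≤ β * 1 := mul_le_mul_of_nonneg_left hl2.le hb.le
      have h10 := mul_nonneg hb.le hr0
      have h11 : A - orderStat X (n - 2 * k) n ω ≤ β * (2 * r) + β * Real.log 2 := by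
        have := (abs_le.1 h1).2
        have := (abs_le.1 h2).1
        linarith
      rw [abs_le]
      constructor <;> linarith
    · rw [Set.indicator_of_notMem hex]
      -- otherwise it is close to the tail quantile of level `n / (k + i)`
      simp only [exceptionalSet, Set.mem_ofPred_eq, not_not] at hex
      obtain ⟨h3, h4⟩ := hex
      have e : ∀ d : ℝ, (n : ℝ) / (((k + i : ℕ) : ℝ) * d) =
          n / k * (k / (((k : ℝ) + i) * d)) := by
        intro d
        push_cast
        field_simp
      rw [e] at h3 h4
      have h5 := abs_sub_log_le (U := U) (b := b) (A₀ := A₀) (C := C) (t := n / k)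
        (m := (k : ℝ) + i) hk0 (by linarith) (by linarith) hδ0 hδ hb hlog h3 h4
      have e2 : Real.log ((k : ℝ) / (k + i)) = -Real.log (((k : ℝ) + i) / k) := by
        rw [← Real.log_inv, inv_div]
      have e3 : n - (k + i) = n - k - i := by omega
      rw [e2, e3] at h5
      have h6 : β * (C * |A₀ (n / k)| + 2 * δ) ≤ β * r := mul_le_mul_of_nonneg_left hr hb.le
      rw [abs_le] at h1 h5 ⊢
      constructor <;> linarith
  set c : ℕ → ℝ := fun i => Real.log (1 + 1 / ((k : ℝ) + (i : ℝ))) with hc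
  have hc0 : ∀ i, 0 ≤ c i := fun i => log_weight_nonneg k i
  have hsum : |weightedSpacings X k n ω -
      β * ∑ i ∈ Finset.range k, c i * Real.log (((k : ℝ) + i) / k)| ≤ β * (2 * r + 2 * δ) := by
    rw [weightedSpacings, Finset.mul_sum, ← Finset.sum_sub_distrib]
    calc _ ≤ ∑ i ∈ Finset.range k, c i * (β * (2 * r +
          2 * (exceptionalSet X U δ n (k + i)).indicator (fun _ => (1 : ℝ)) ω)) := by
          refine (Finset.abs_sum_le_sum_abs _ _).trans (Finset.sum_le_sum fun i hi => ?_)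
          have e : Real.log (1 + 1 / ((k : ℝ) + (i : ℝ))) *
              (A - orderStat X (n - k - i) n ω) - β * (c i * Real.log (((k : ℝ) + i) / k)) =
              c i * (A - orderStat X (n - k - i) n ω - β * Real.log (((k : ℝ) + i) / k)) := by
            simp only [hc]
            ring
          rw [e, abs_mul, abs_of_nonneg (hc0 i)]
          exact mul_le_mul_of_nonneg_left (hterm i hi) (hc0 i)
      _ = β * (2 * r) * ∑ i ∈ Finset.range k, c i + β * 2 * ∑ i ∈ Finset.range k,
          c i * (exceptionalSet X U δ n (k + i)).indicator (fun _ => (1 : ℝ)) ω := by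
        rw [Finset.mul_sum, Finset.mul_sum, ← Finset.sum_add_distrib]
        refine Finset.sum_congr rfl fun i _ => ?_
        ring
      _ ≤ β * (2 * r) * 1 + β * 2 * δ := by
        have h3 : ∑ i ∈ Finset.range k,
            c i * (exceptionalSet X U δ n (k + i)).indicator (fun _ => (1 : ℝ)) ω ≤ δ := by
          calc _ ≤ ∑ i ∈ Finset.range k, 1 / (k : ℝ) *
                (exceptionalSet X U δ n (k + i)).indicator (fun _ => (1 : ℝ)) ω := by
                refine Finset.sum_le_sum fun i _ => ?_
                exact mul_le_mul_of_nonneg_right (log_weight_le hk i)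
                  (Set.indicator_nonneg (fun _ _ => zero_le_one) ω)
            _ ≤ 1 / (k : ℝ) * (δ * k) := by
              rw [← Finset.mul_sum]
              gcongr
            _ = δ := by field_simp
        have h4 : ∑ i ∈ Finset.range k, c i = Real.log 2 := sum_log_weight hk
        rw [h4]
        gcongr
      _ = _ := by ring
  have h3 := mul_le_mul_of_nonneg_left (abs_sum_log_weight_mul_log k hk) hb.le
  rw [← abs_of_pos hb, ← abs_mul, abs_of_pos hb, mul_sub] at h3
  rw [abs_le] at *
  constructor <;> linarith

/-- The algebra behind the Slutsky argument, in units of the scale function: `q` and `q'` are the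
two centred intermediate order statistics, `s` is the weighted sum of spacings, and `v` is the
normalized maximum. -/
lemma abs_ratio_sub_le {v q q' s r r' ℓ : ℝ} (hr : r ≤ 1 / 20) (hq : |q| ≤ r)
    (hq' : |q' + Real.log 2| ≤ r) (hs : |s - Real.log 2 ^ 2 / 2| ≤ r') (hv : |v| ≤ ℓ) :
    |(Real.log 2 * (v + ℓ - q) + s) / (q - q') - (ℓ + Real.log 2 / 2) - v| ≤
      2 * (4 * (r * ℓ) + 2 * r + r') := by
  have hl1 : Real.log 2 < 0.6931471808 := Real.log_two_lt_d9
  have hl2 : 0.6931471803 < Real.log 2 := Real.log_two_gt_d9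
  set l := Real.log 2
  have hr0 : 0 ≤ r := (abs_nonneg _).trans hq
  have hℓ : 0 ≤ ℓ := (abs_nonneg _).trans hv
  set d := q - q' with hd
  have hdl : |l - d| ≤ 2 * r := by
    rw [abs_le] at *
    constructor <;> linarith
  have hd2 : 1 / 2 ≤ d := by
    have := (abs_le.1 hdl).2
    linarith
  have hd0 : 0 < d := by linarith
  have e : (l * (v + ℓ - q) + s) / d - (ℓ + l / 2) - v =
      ((l - d) * (v + ℓ) - l * q + (s - l ^ 2 / 2) + l / 2 * (l - d)) / d := by
    field_simp
    ring
  have h1 : |(l - d) * (v + ℓ)| ≤ 2 * r * (2 * ℓ) := by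
    rw [abs_mul]
    have : |v + ℓ| ≤ 2 * ℓ := by
      rw [abs_le] at *
      constructor <;> linarith
    gcongr
  have h2 : |l * q| ≤ 1 * r := by
    rw [abs_mul, abs_of_pos (by linarith : 0 < l)]
    gcongr
    linarith
  have h3 : |l / 2 * (l - d)| ≤ 1 / 2 * (2 * r) := by
    rw [abs_mul, abs_of_pos (by linarith : 0 < l / 2)]
    gcongr
    linarith
  have hr'0 : 0 ≤ r' := (abs_nonneg _).trans hs
  have h4 : |(l - d) * (v + ℓ) - l * q + (s - l ^ 2 / 2) + l / 2 * (l - d)| ≤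
      4 * (r * ℓ) + 2 * r + r' := by
    rw [abs_le] at *
    constructor <;> linarith
  rw [e, abs_div, abs_of_pos hd0, div_le_iff₀ hd0]
  refine h4.trans ?_
  have h5 : 0 ≤ 4 * (r * ℓ) + 2 * r + r' := by positivity
  nlinarith

/-! ### Index zero -/

section Asymptotics

variable {Ω : Type*} [MeasurableSpace Ω] {P : Measure Ω} {μ : Measure ℝ}
  [IsProbabilityMeasure μ] {X : ℕ → Ω → ℝ} {k : ℕ → ℕ}

/-- The normalized and centred sample maximum. -/
def normalizedMax {Ω : Type*} (X : ℕ → Ω → ℝ) (U b : ℝ → ℝ) (k n : ℕ) (ω : Ω) : ℝ :=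
  (orderStat X n n ω - U (n / k)) / b (n / k) - Real.log k

lemma tendsto_rpow_mul_rate {A₀ : ℝ → ℝ} {lam : ℝ} (hk : Tendsto k atTop atTop)
    (hkA : Tendsto (fun n : ℕ => Real.sqrt (k n) * A₀ ((n : ℝ) / (k n : ℝ))) atTop (𝓝 lam)) :
    Tendsto (fun n : ℕ => (k n : ℝ) ^ (1 / 4 : ℝ) * |A₀ (n / k n)|) atTop (𝓝 0) := by
  have hkR : Tendsto (fun n => (k n : ℝ)) atTop atTop := tendsto_natCast_atTop_atTop.comp hk
  have h1 := ((tendsto_rpow_neg_atTop (show (0 : ℝ) < 1 / 4 by norm_num)).comp hkR).mul hkA.abs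
  rw [zero_mul] at h1
  refine h1.congr' ?_
  filter_upwards [hk.eventually_ge_atTop 1] with n hk1
  have hk0 : (0 : ℝ) < k n := by exact_mod_cast hk1
  simp only [Function.comp]
  rw [abs_mul, abs_of_nonneg (Real.sqrt_nonneg _), Real.sqrt_eq_rpow, ← mul_assoc,
    ← Real.rpow_add hk0]
  norm_num

/-- The normalized maximum converges in law to the Gumbel distribution: its distribution function
is an `n`-th power, squeezed between `(1 - exp (-y) / n) ^ n` for `y` slightly off `z`. -/
lemma tendsto_cdf_normalizedMax (hX : ∀ i, Measurable (X i)) (hindep : iIndepFun X P)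
    (hlaw : ∀ i, P.map (X i) = μ) {ρ lam : ℝ} {a A₀ : ℝ → ℝ}
    (hU : SecondOrderCondition (tailQuantile (cdf μ)) 0 ρ a A₀) (hk : Tendsto k atTop atTop)
    (hkn : Tendsto (fun n : ℕ => (k n : ℝ) / (n : ℝ)) atTop (𝓝 0))
    (hkA : Tendsto (fun n : ℕ => Real.sqrt (k n) * A₀ ((n : ℝ) / (k n : ℝ))) atTop (𝓝 lam))
    (z : ℝ) :
    Tendsto (fun n => P.real {ω |
      normalizedMax X (tailQuantile (cdf μ)) (scaleZero 0 ρ a A₀) (k n) n ω ≤ z}) atTop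
      (𝓝 (gev 0 z)) := by
  have ht := tendsto_ratio hk hkn
  have hkR : Tendsto (fun n => (k n : ℝ)) atTop atTop := tendsto_natCast_atTop_atTop.comp hk
  obtain ⟨C, T, hC, hlog⟩ := hU.increment_log monotoneOn_tailQuantile
  have hb := hU.scaleZero_pos
  set U := tailQuantile (cdf μ) with hUdef
  set b := scaleZero 0 ρ a A₀
  set u : ℕ → ℝ := fun n => U (n / k n) + b (n / k n) * (z + Real.log (k n)) with hu
  have hprob : ∀ᶠ n : ℕ in atTop,
      P.real {ω | normalizedMax X U b (k n) n ω ≤ z} = cdf μ (u n) ^ n := by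
    filter_upwards [eventually_ge_atTop 1, ht.eventually hb] with n hn hb
    rw [cdf_eq_real, ← measureReal_forall_mem hX hindep hlaw n measurableSet_Iic]
    congr 1
    ext ω
    change normalizedMax X U b (k n) n ω ≤ z ↔ ∀ i < n, X i ω ≤ u n
    rw [← orderStat_top_le_iff hn, normalizedMax, sub_le_iff_le_add, div_le_iff₀ hb,
      sub_le_iff_le_add, hu]
    constructor <;> intro h <;> linarith
  -- the quantile of level `1 - exp (-y) / n` in the coordinates of the normalized maximum
  have hquant : ∀ y : ℝ, Tendsto (fun n : ℕ =>
      (U (n * Real.exp y) - U (n / k n)) / b (n / k n) - Real.log (k n)) atTop (𝓝 y) := by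
    intro y
    have h1 := (tendsto_rpow_mul_rate hk hkA).const_mul (C * Real.exp y ^ (1 / 4 : ℝ))
    rw [mul_zero] at h1
    rw [tendsto_iff_norm_sub_tendsto_zero]
    refine squeeze_zero' (Eventually.of_forall fun _ => norm_nonneg _) ?_ h1
    filter_upwards [ht.eventually hb, ht.eventually_ge_atTop T, hk.eventually_ge_atTop 1,
      hkR.eventually_ge_atTop (Real.exp (-y))] with n hb hT hk1 hky
    have hk0 : (0 : ℝ) < k n := by exact_mod_cast hk1
    have hx : 1 ≤ k n * Real.exp y := by
      calc (1 : ℝ) = Real.exp (-y) * Real.exp y := by rw [← Real.exp_add]; simp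
        _ ≤ _ := by gcongr
    have h2 := (hlog _ hT).2 _ hx
    have e1 : (n : ℝ) / k n * (k n * Real.exp y) = n * Real.exp y := by field_simp
    rw [e1, Real.log_mul hk0.ne' (Real.exp_pos y).ne', Real.log_exp,
      Real.mul_rpow hk0.le (Real.exp_pos y).le] at h2
    have e2 : (U (n * Real.exp y) - U (n / k n)) / b (n / k n) - Real.log (k n) - y =
        (U (n * Real.exp y) - U (n / k n) - b (n / k n) * (Real.log (k n) + y)) /
          b (n / k n) := by
      field_simp
      ring
    rw [Real.norm_eq_abs, e2, abs_div, abs_of_pos hb, div_le_iff₀ hb]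
    refine h2.trans (le_of_eq ?_)
    ring
  have hlevel : ∀ y : ℝ, ∀ᶠ n : ℕ in atTop, 1 < n * Real.exp y := fun y =>
    (tendsto_natCast_atTop_atTop.atTop_mul_const (Real.exp_pos y)).eventually_gt_atTop 1
  have elevel : ∀ (y : ℝ) (n : ℕ), 1 - 1 / ((n : ℝ) * Real.exp y) = 1 - Real.exp (-y) / n := by
    intro y n
    rw [Real.exp_neg, div_eq_mul_inv, div_eq_mul_inv, mul_inv]
    ring
  have hlevel0 : ∀ y : ℝ, ∀ᶠ n : ℕ in atTop, 0 ≤ 1 - Real.exp (-y) / n := by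
    intro y
    filter_upwards [hlevel y] with n hn
    rw [← elevel]
    exact (level_pos hn).le
  refine Tendsto.congr' (hprob.mono fun n hn => hn.symm) ?_
  refine tendsto_order.2 ⟨fun v hv => ?_, fun v hv => ?_⟩
  · obtain ⟨y, hyz, hy⟩ : ∃ y < z, v < gev 0 y := by
      have h1 := (continuous_gev_zero.tendsto z).eventually (lt_mem_nhds hv)
      have h2 : ∀ᶠ y in 𝓝[<] z, v < gev 0 y := h1.filter_mono nhdsWithin_le_nhds
      obtain ⟨y, h3, h4⟩ := (h2.and self_mem_nhdsWithin).exists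
      exact ⟨y, h4, h3⟩
    filter_upwards [(tendsto_one_sub_exp_div_pow y).eventually (lt_mem_nhds hy), hlevel y,
      (hquant y).eventually (gt_mem_nhds hyz), ht.eventually hb, hlevel0 y]
      with n h1 h2 h3 hb h0
    refine h1.trans_le ?_
    rw [sub_lt_iff_lt_add, div_lt_iff₀ hb] at h3
    have h4 : U (n * Real.exp y) ≤ u n := by
      simp only [hu]
      linarith
    have h5 := (tailQuantile_le_iff h2).1 h4
    rw [elevel] at h5
    gcongr
  · obtain ⟨y, hyz, hy⟩ : ∃ y, z < y ∧ gev 0 y < v := by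
      have h1 := (continuous_gev_zero.tendsto z).eventually (gt_mem_nhds hv)
      have h2 : ∀ᶠ y in 𝓝[>] z, gev 0 y < v := h1.filter_mono nhdsWithin_le_nhds
      obtain ⟨y, h3, h4⟩ := (h2.and self_mem_nhdsWithin).exists
      exact ⟨y, h4, h3⟩
    filter_upwards [(tendsto_one_sub_exp_div_pow y).eventually (gt_mem_nhds hy), hlevel y,
      (hquant y).eventually (lt_mem_nhds hyz), ht.eventually hb] with n h1 h2 h3 hb
    refine lt_of_le_of_lt ?_ h1
    rw [lt_sub_iff_add_lt, lt_div_iff₀ hb] at h3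
    have h4 : ¬ U (n * Real.exp y) ≤ u n := by
      simp only [hu, not_le]
      linarith
    have h5 := (tailQuantile_le_iff h2).not.1 h4
    rw [elevel, not_le] at h5
    have := cdf_nonneg μ (u n)
    gcongr

variable [IsProbabilityMeasure P]

/-- A sequence converging in law is bounded with high probability by any diverging sequence. -/
lemma withHighProb_abs_le_of_tendsto_cdf {ν : Measure ℝ} {V : ℕ → Ω → ℝ}
    (hV : ∀ n, Measurable (V n))
    (h : ∀ z, Tendsto (fun n => P.real {ω | V n ω ≤ z}) atTop (𝓝 (cdf ν z)))
    {K : ℕ → ℝ} (hK : Tendsto K atTop atTop) : WithHighProb P fun n ω => |V n ω| ≤ K n := by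
  unfold WithHighProb
  refine tendsto_order.2 ⟨fun y hy => Eventually.of_forall fun n => hy.trans_le measureReal_nonneg,
    fun ε hε => ?_⟩
  obtain ⟨z₁, hz₁⟩ := ((tendsto_cdf_atBot ν).eventually
    (gt_mem_nhds (half_pos hε))).exists
  obtain ⟨z₂, hz₂⟩ := ((tendsto_cdf_atTop ν).eventually
    (lt_mem_nhds (show 1 - ε / 2 < 1 by linarith))).exists
  filter_upwards [(h z₁).eventually (gt_mem_nhds hz₁), (h z₂).eventually (lt_mem_nhds hz₂),
    hK.eventually_ge_atTop (-z₁), hK.eventually_ge_atTop z₂] with n h1 h2 h3 h4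
  have hsub : {ω | ¬ |V n ω| ≤ K n} ⊆ {ω | V n ω ≤ z₁} ∪ {ω | V n ω ≤ z₂}ᶜ := by
    intro ω hω
    by_contra hcon
    simp only [Set.mem_union, Set.mem_compl_iff, Set.mem_ofPred_eq, not_or, not_le]
      at hcon
    exact hω (abs_le.2 ⟨by linarith, by linarith⟩)
  have h5 : P.real {ω | V n ω ≤ z₂}ᶜ = 1 - P.real {ω | V n ω ≤ z₂} :=
    probReal_compl_eq_one_sub (measurableSet_le (hV n) measurable_const)
  have h6 := (measureReal_mono (μ := P) hsub).trans (measureReal_union_le _ _)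
  linarith

lemma measurableSet_exceptionalSet (hX : ∀ i, Measurable (X i)) (U : ℝ → ℝ) (δ : ℝ) (n m : ℕ) :
    MeasurableSet (exceptionalSet X U δ n m) :=
  ((measurableSet_le measurable_const (measurable_orderStat hX _ _)).inter
    (measurableSet_le (measurable_orderStat hX _ _) measurable_const)).compl

/-- By Markov's inequality, with high probability only a proportion `k ^ (-1 / 4)` of the indices
between `k` and `2 k` is exceptional at the accuracy `k ^ (-1 / 4)`. -/
lemma withHighProb_few_exceptional (hX : ∀ i, Measurable (X i)) (hindep : iIndepFun X P)
    (hlaw : ∀ i, P.map (X i) = μ) (hk : Tendsto k atTop atTop)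
    (hkn : Tendsto (fun n : ℕ => (k n : ℝ) / (n : ℝ)) atTop (𝓝 0)) :
    WithHighProb P fun n ω => ∑ i ∈ Finset.range (k n),
      (exceptionalSet X (tailQuantile (cdf μ)) ((k n : ℝ) ^ (-(1 / 4) : ℝ)) n (k n + i)).indicator
        (fun _ => (1 : ℝ)) ω ≤ (k n : ℝ) ^ (-(1 / 4) : ℝ) * k n := by
  have hkR : Tendsto (fun n => (k n : ℝ)) atTop atTop := tendsto_natCast_atTop_atTop.comp hk
  have hδlim : Tendsto (fun n => (k n : ℝ) ^ (-(1 / 4) : ℝ)) atTop (𝓝 0) :=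
    (tendsto_rpow_neg_atTop (by norm_num)).comp hkR
  have hlim := hδlim.const_mul 3
  rw [mul_zero] at hlim
  refine WithHighProb.of_le hlim ?_
  filter_upwards [hk.eventually_ge_atTop 1, hδlim.eventually (gt_mem_nhds one_pos),
    eventually_mul_lt hkn 4 (by norm_num)] with n hk1 hδ1 hn
  have hk0 : (0 : ℝ) < k n := by exact_mod_cast hk1
  have hδ0 : 0 < (k n : ℝ) ^ (-(1 / 4) : ℝ) := by positivity
  have hδ4 : ((k n : ℝ) ^ (-(1 / 4) : ℝ)) ^ 4 * k n = 1 := by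
    rw [← Real.rpow_natCast, ← Real.rpow_mul hk0.le]
    norm_num
    rw [Real.rpow_neg_one]
    field_simp
  set δ := (k n : ℝ) ^ (-(1 / 4) : ℝ)
  set B : ℕ → Set Ω := fun i => exceptionalSet X (tailQuantile (cdf μ)) δ n (k n + i) with hB
  have hBm : ∀ i, MeasurableSet (B i) := fun i => measurableSet_exceptionalSet hX _ _ _ _
  have hBP : ∀ i ∈ Finset.range (k n), P.real (B i) ≤ 3 * δ ^ 2 := by
    intro i hi
    have hi' : i < k n := Finset.mem_range.1 hi
    have h1 : (k n : ℝ) ≤ ((k n + i : ℕ) : ℝ) := by exact_mod_cast Nat.le_add_right _ _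
    have h2 : 2 * ((k n + i : ℕ) : ℝ) < n := by
      have : 2 * (k n + i) < n := by omega
      exact_mod_cast this
    refine (measureReal_not_orderStat_mem hX hindep hlaw (m := k n + i) (by omega) hδ0 hδ1
      (by nlinarith)).trans ?_
    calc 3 / (δ ^ 2 * ((k n + i : ℕ) : ℝ)) ≤ 3 / (δ ^ 2 * k n) := by gcongr
      _ = 3 * δ ^ 2 := by
        rw [div_eq_iff (by positivity)]
        linear_combination (-3) * hδ4
  have hint : ∀ i ∈ Finset.range (k n),
      Integrable (fun ω => (B i).indicator (fun _ => (1 : ℝ)) ω) P :=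
    fun i _ => (integrable_const (1 : ℝ)).indicator (hBm i)
  have hmarkov := mul_meas_ge_le_integral_of_nonneg (μ := P)
    (f := fun ω => ∑ i ∈ Finset.range (k n), (B i).indicator (fun _ => (1 : ℝ)) ω)
    (ae_of_all _ fun ω => Finset.sum_nonneg fun i _ =>
      Set.indicator_nonneg (fun _ _ => zero_le_one) ω)
    (integrable_finsetSum _ hint) (δ * k n)
  rw [integral_finsetSum _ hint] at hmarkov
  have h3 : ∑ i ∈ Finset.range (k n), ∫ ω, (B i).indicator (fun _ => (1 : ℝ)) ω ∂P ≤
      k n * (3 * δ ^ 2) := by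
    calc _ ≤ ∑ i ∈ Finset.range (k n), 3 * δ ^ 2 := by
          refine Finset.sum_le_sum fun i hi => ?_
          rw [integral_indicator_const _ (hBm i), smul_eq_mul, mul_one]
          exact hBP i hi
      _ = _ := by simp
  have h4 : P.real {ω | δ * k n ≤
      ∑ i ∈ Finset.range (k n), (B i).indicator (fun _ => (1 : ℝ)) ω} ≤ 3 * δ := by
    have h5 := hmarkov.trans h3
    have h6 : 0 < δ * k n := by positivity
    refine le_of_mul_le_mul_left (h5.trans (le_of_eq ?_)) h6
    ring
  exact (measureReal_mono fun ω hω => (not_le.1 hω).le).trans h4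

/-- For index zero the test statistic and the normalized maximum are asymptotically equivalent. -/
lemma withHighProb_abs_testStatStar_sub_lt (hX : ∀ i, Measurable (X i)) (hindep : iIndepFun X P)
    (hlaw : ∀ i, P.map (X i) = μ) {ρ lam : ℝ} {a A₀ : ℝ → ℝ}
    (hU : SecondOrderCondition (tailQuantile (cdf μ)) 0 ρ a A₀) (hk : Tendsto k atTop atTop)
    (hkn : Tendsto (fun n : ℕ => (k n : ℝ) / (n : ℝ)) atTop (𝓝 0))
    (hkA : Tendsto (fun n : ℕ => Real.sqrt (k n) * A₀ ((n : ℝ) / (k n : ℝ))) atTop (𝓝 lam))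
    (hV : WithHighProb P fun n ω =>
      |normalizedMax X (tailQuantile (cdf μ)) (scaleZero 0 ρ a A₀) (k n) n ω| ≤ Real.log (k n))
    {ε : ℝ} (hε : 0 < ε) :
    WithHighProb P fun n ω => |testStatStar X (k n) n ω -
      normalizedMax X (tailQuantile (cdf μ)) (scaleZero 0 ρ a A₀) (k n) n ω| < ε := by
  have ht := tendsto_ratio hk hkn
  have hkR : Tendsto (fun n => (k n : ℝ)) atTop atTop := tendsto_natCast_atTop_atTop.comp hk
  obtain ⟨C, T, hC, hlog⟩ := hU.increment_log monotoneOn_tailQuantile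
  have hb := hU.scaleZero_pos
  set U := tailQuantile (cdf μ) with hUdef
  set b := scaleZero 0 ρ a A₀
  set δ : ℕ → ℝ := fun n => (k n : ℝ) ^ (-(1 / 4) : ℝ) with hδdef
  set r : ℕ → ℝ := fun n => C * |A₀ (n / k n)| + 2 * δ n with hrdef
  have hδlim : Tendsto δ atTop (𝓝 0) := (tendsto_rpow_neg_atTop (by norm_num)).comp hkR
  -- both parts of `r` are `O (k ^ (-1 / 4))`
  have hrlim : Tendsto r atTop (𝓝 0) := by
    have h1 := ((hU.rate_tendsto.comp ht).abs.const_mul C).add (hδlim.const_mul 2)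
    simpa [Function.comp_def] using h1
  have hrlog : Tendsto (fun n => r n * Real.log (k n)) atTop (𝓝 0) := by
    have hlo : Tendsto (fun x : ℝ => Real.log x / x ^ (1 / 4 : ℝ)) atTop (𝓝 0) :=
      (isLittleO_log_rpow_atTop (by norm_num)).tendsto_div_nhds_zero
    have h1 := (((tendsto_rpow_mul_rate hk hkA).const_mul C).add_const 2).mul (hlo.comp hkR)
    rw [mul_zero] at h1
    refine h1.congr' ?_
    filter_upwards [hk.eventually_ge_atTop 1] with n hk1
    have hk0 : (0 : ℝ) < k n := by exact_mod_cast hk1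
    have hp : (0 : ℝ) < (k n : ℝ) ^ (1 / 4 : ℝ) := by positivity
    simp only [Function.comp, hrdef, hδdef, Real.rpow_neg hk0.le]
    field_simp
  have hfinal : Tendsto (fun n => 2 * (4 * (r n * Real.log (k n)) + 2 * r n +
      (2 * r n + 2 * δ n + 1 / k n))) atTop (𝓝 0) := by
    have h1 := (((hrlog.const_mul 4).add (hrlim.const_mul 2)).add
      (((hrlim.const_mul 2).add (hδlim.const_mul 2)).add (hkR.const_div_atTop 1))).const_mul 2
    simpa using h1
  have hk1 := hk.eventually_ge_atTop 1
  have hδ : ∀ᶠ n in atTop, 0 < δ n ∧ δ n < 1 := by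
    filter_upwards [hk1, hδlim.eventually (gt_mem_nhds one_pos)] with n hk1 h1
    have hk0 : (0 : ℝ) < k n := by exact_mod_cast hk1
    exact ⟨Real.rpow_pos_of_pos hk0 _, h1⟩
  have hδ2 : Tendsto (fun n => δ n ^ 2 * k n) atTop atTop := by
    refine (Real.tendsto_sqrt_atTop.comp hkR).congr' ?_
    filter_upwards [hk1] with n hk1
    have hk0 : (0 : ℝ) < k n := by exact_mod_cast hk1
    simp only [Function.comp, hδdef]
    rw [← Real.rpow_natCast, ← Real.rpow_mul hk0.le, Real.sqrt_eq_rpow]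
    nth_rewrite 3 [← Real.rpow_one (k n : ℝ)]
    rw [← Real.rpow_add hk0]
    norm_num
  have hw1 := withHighProb_orderStat (P := P) hX hindep hlaw (m := k) hk1 hδ
    (eventually_mul_lt hkn 2 (by norm_num)) hδ2
  have hw2 := withHighProb_orderStat (P := P) hX hindep hlaw (m := fun n => 2 * k n) (δ := δ)
    (hk1.mono fun n hn => by omega) hδ
    ((eventually_mul_lt hkn 4 (by norm_num)).mono fun n hn => by omega)
    ((hδ2.const_mul_atTop two_pos).congr fun n => by push_cast; ring)
  have hw3 := withHighProb_few_exceptional (P := P) hX hindep hlaw hk hkn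
  refine ((hw1.and hw2).and (hw3.and hV)).mono ?_
  filter_upwards [hk1, hδ, hδlim.eventually (gt_mem_nhds (show (0 : ℝ) < 1 / 2 by norm_num)),
    hrlim.eventually (gt_mem_nhds (show (0 : ℝ) < 1 / 20 by norm_num)),
    hfinal.eventually (gt_mem_nhds hε), ht.eventually hb, ht.eventually_ge_atTop T,
    eventually_mul_lt hkn 2 two_pos] with n hk1 hδ hδ2 hr20 hfin hb hT hn ω hω
  obtain ⟨⟨⟨g1, g2⟩, ⟨g3, g4⟩⟩, ⟨g5, g6⟩⟩ := hω
  have hk0 : (0 : ℝ) < k n := by exact_mod_cast hk1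
  have hlogn := (hlog _ hT).1
  have e1 : ∀ d : ℝ, (n : ℝ) / (k n * d) = n / k n * (k n / (k n * d)) := by
    intro d
    field_simp
  have e2 : ∀ d : ℝ, (n : ℝ) / (((2 * k n : ℕ) : ℝ) * d) =
      n / k n * (k n / (2 * k n * d)) := by
    intro d
    push_cast
    field_simp
  rw [e1] at g1 g2
  rw [e2] at g3 g4
  have h1 := abs_sub_log_le (U := U) (b := b) (A₀ := A₀) (m := (k n : ℝ)) hk0 le_rfl
    (by linarith) hδ.1.le hδ2.le hb hlogn g1 g2
  have h2 := abs_sub_log_le (U := U) (b := b) (A₀ := A₀) (m := 2 * (k n : ℝ)) hk0 (by linarith)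
    le_rfl hδ.1.le hδ2.le hb hlogn g3 g4
  have e3 : Real.log ((k n : ℝ) / (2 * k n)) = -Real.log 2 := by
    rw [← Real.log_inv]
    congr 1
    field_simp
  rw [div_self hk0.ne', Real.log_one, mul_zero, sub_zero] at h1
  rw [e3, mul_neg, sub_neg_eq_add] at h2
  have h3 := abs_weightedSpacings_sub_le (r := r n) hk1 hn hδ.1.le hδ2.le hb le_rfl hlogn h1 h2 g5
  rw [testStatStar, log_two_mul_testStat hk1]
  set t := (n : ℝ) / k n
  set A := orderStat X (n - k n) n ω
  set B := orderStat X (n - 2 * k n) n ω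
  set S := weightedSpacings X (k n) n ω
  have hscale : ∀ {x y : ℝ}, |x| ≤ b t * y → |x / b t| ≤ y := by
    intro x y hxy
    rw [abs_div, abs_of_pos hb, div_le_iff₀ hb]
    linarith
  have h4 : |(A - U t) / b t| ≤ r n := hscale h1
  have h5 : |(B - U t) / b t + Real.log 2| ≤ r n := by
    have : (B - U t) / b t + Real.log 2 = (B - U t + b t * Real.log 2) / b t := by field_simp
    rw [this]
    exact hscale h2
  have h6 : |S / b t - Real.log 2 ^ 2 / 2| ≤ 2 * r n + 2 * δ n + 1 / k n := by
    have : S / b t - Real.log 2 ^ 2 / 2 = (S - b t * (Real.log 2 ^ 2 / 2)) / b t := by field_simp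
    rw [this]
    exact hscale h3
  have h7 := abs_ratio_sub_le hr20.le h4 h5 h6 g6
  have e4 : (Real.log 2 * (normalizedMax X U b (k n) n ω + Real.log (k n) - (A - U t) / b t) +
      S / b t) / ((A - U t) / b t - (B - U t) / b t) =
      (Real.log 2 * (orderStat X n n ω - A) + S) / (A - B) := by
    have e5 : Real.log 2 * (normalizedMax X U b (k n) n ω + Real.log (k n) - (A - U t) / b t) +
        S / b t = (Real.log 2 * (orderStat X n n ω - A) + S) / b t := by
      have e6 : normalizedMax X U b (k n) n ω + Real.log (k n) =
          (orderStat X n n ω - U t) / b t := sub_add_cancel _ _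
      rw [e6]
      field_simp
      ring
    rw [e5, ← sub_div, sub_sub_sub_cancel_right, div_div_div_cancel_right₀ hb.ne']
  rw [e4] at h7
  exact h7.trans_lt hfin

lemma measurable_normalizedMax (hX : ∀ i, Measurable (X i)) (U b : ℝ → ℝ) (k n : ℕ) :
    Measurable (normalizedMax X U b k n) := by
  have h := measurable_orderStat hX n n
  unfold normalizedMax
  fun_prop

/-- For index zero the test statistic converges in law to the Gumbel distribution. -/
lemma tendstoInDistribution_testStatStar (hX : ∀ i, Measurable (X i)) (hindep : iIndepFun X P)
    (hlaw : ∀ i, P.map (X i) = μ) {ρ lam : ℝ} {a A₀ : ℝ → ℝ}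
    (hU : SecondOrderCondition (tailQuantile (cdf μ)) 0 ρ a A₀) (hk : Tendsto k atTop atTop)
    (hkn : Tendsto (fun n : ℕ => (k n : ℝ) / (n : ℝ)) atTop (𝓝 0))
    (hkA : Tendsto (fun n : ℕ => Real.sqrt (k n) * A₀ ((n : ℝ) / (k n : ℝ))) atTop (𝓝 lam))
    {ν : Measure ℝ} [IsProbabilityMeasure ν] (hν : ∀ z, cdf ν z = gev 0 z) :
    TendstoInDistribution (fun n : ℕ => testStatStar X (k n) n) atTop (fun z : ℝ => z)
      (fun _ => P) ν := by
  have hkR : Tendsto (fun n => (k n : ℝ)) atTop atTop := tendsto_natCast_atTop_atTop.comp hk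
  set V : ℕ → Ω → ℝ := fun n =>
    normalizedMax X (tailQuantile (cdf μ)) (scaleZero 0 ρ a A₀) (k n) n
  have hVm : ∀ n, Measurable (V n) := fun n => measurable_normalizedMax hX _ _ _ _
  have hVcdf : ∀ z, Tendsto (fun n => P.real {ω | V n ω ≤ z}) atTop (𝓝 (cdf ν z)) := by
    intro z
    rw [hν]
    exact tendsto_cdf_normalizedMax hX hindep hlaw hU hk hkn hkA z
  have hVb := withHighProb_abs_le_of_tendsto_cdf hVm hVcdf (Real.tendsto_log_atTop.comp hkR)
  refine tendstoInDistribution_of_tendstoInMeasure_sub (X := V) _ _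
    (tendstoInDistribution_of_tendsto_cdf hVm hVcdf) ?_
    fun n => (measurable_testStatStar hX _ _).aemeasurable
  rw [tendstoInMeasure_iff_measureReal_norm]
  intro ε hε
  have h := withHighProb_abs_testStatStar_sub_lt hX hindep hlaw hU hk hkn hkA hVb hε
  refine Tendsto.congr (fun n => ?_) h
  congr 1
  ext ω
  simp only [Pi.sub_apply, Pi.zero_apply, sub_zero, Real.norm_eq_abs]
  exact not_lt

end Asymptotics

end EndpointTest

end

theorem theorem2
    {Ω : Type*} [MeasurableSpace Ω] (P : Measure Ω) [IsProbabilityMeasure P]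
    (μ : Measure ℝ) [IsProbabilityMeasure μ]
    (X : ℕ → Ω → ℝ)
    (hX_meas : ∀ i, Measurable (X i))
    (hX_indep : iIndepFun X P)
    (hX_law : ∀ i, P.map (X i) = μ)
    (γ ρ lam : ℝ) (a A₀ : ℝ → ℝ)
    (hF : EndpointTest.MaxDomain (cdf μ) γ)
    (hU : EndpointTest.SecondOrderCondition (EndpointTest.tailQuantile (cdf μ)) γ ρ a A₀)
    (k : ℕ → ℕ)
    (hk : Tendsto k atTop atTop)
    (hkn : Tendsto (fun n : ℕ => (k n : ℝ) / (n : ℝ)) atTop (𝓝 0))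
    (hkA : Tendsto (fun n : ℕ => Real.sqrt (k n) * A₀ ((n : ℝ) / (k n : ℝ))) atTop (𝓝 lam)) :
    (γ = 0 →
      ∃ (ν : Measure ℝ) (_ : IsProbabilityMeasure ν),
        (∀ z : ℝ, cdf ν z = EndpointTest.gev 0 z) ∧
        TendstoInDistribution (fun n : ℕ => EndpointTest.testStatStar X (k n) n) atTop
          (fun z : ℝ => z) (fun _ => P) ν) ∧
    (0 < γ → ∀ M : ℝ,
      Tendsto (fun n : ℕ => P {ω | M < EndpointTest.testStatStar X (k n) n ω}) atTop (𝓝 1)) ∧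
    (γ < 0 → ∀ M : ℝ,
      Tendsto (fun n : ℕ => P {ω | EndpointTest.testStatStar X (k n) n ω < M}) atTop (𝓝 1)) := by
  refine ⟨?_, fun hγ M => ?_, fun hγ M => ?_⟩
  · rintro rfl
    obtain ⟨ν, hν, hcdf⟩ := EndpointTest.exists_gumbel
    exact ⟨ν, hν, hcdf, EndpointTest.tendstoInDistribution_testStatStar hX_meas hX_indep hX_law
      hU hk hkn hkA hcdf⟩
  · exact (EndpointTest.withHighProb_lt_testStatStar hX_meas hX_indep hX_law hU hk hkn hγ
      M).tendsto_one fun n =>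
        measurableSet_lt measurable_const (EndpointTest.measurable_testStatStar hX_meas _ _)
  · exact (EndpointTest.withHighProb_testStatStar_lt hX_meas hX_indep hX_law hU hk hkn hγ
      M).tendsto_one fun n =>
        measurableSet_lt (EndpointTest.measurable_testStatStar hX_meas _ _) measurable_const
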